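/- A composition $\alpha=(\alpha_1,\dots,\alpha_k)\vDash n$ is a finite list of positive integers with sum $n=|\alpha|$; its length is $\ell(\alpha)=k$, $\mathrm{tail}(\alpha)=(\alpha_2,\dots,\alpha_k)$, and $\mathrm{set}(\alpha)=\{\alpha_1,\alpha_1+\alpha_2,\dots,\alpha_1+\cdots+\alpha_{k-1}\}\subseteq[n-1]$. This is a bijection between compositions of $n$ and subsets of $[n-1]$, with inverse $\mathrm{comp}$. Let $R$ be a commutative ring of coefficients. *Quasisymmetric functions.* Put $M_\alpha=\sum_{i_1<\cdots<i_k}x_{i_1}^{\alpha_1}\cdots x_{i_k}^{\alpha_k}$ and $F_\alpha=\sum x_{i_1}\cdots x_{i_n}$, the latter sum over $i_1\le\cdots\le i_n$ such that $i_j=i_{j+1}$ implies $j\notin\mathrm{set}(\alpha)$. The diagram of $\alpha$ has $\alpha_i$ left-justified boxes in row $i$ from the bottom. A standard immaculate tableau $T$ of shape $\alpha$ is a bijective filling of it with $1,\dots,n$ whose leftmost column increases from bottom to top and whose rows increase from left to right; $\mathrm{Des}(T)\subseteq[n-1]$ is the set of $i$ such that $i+1$ lies in a row strictly above that of $i$.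 The row-strict dual immaculate function is $\mathcal{R}\mathfrak{S}^*_\alpha=\sum_T F_{\mathrm{comp}(\mathrm{Des}(T)^c)}$, over all standard immaculate tableaux $T$ of shape $\alpha$, where the complement is taken in $[n-1]$. *Noncommutative symmetric functions.* $\mathrm{NSym}$ is the free associative $R$-algebra on the complete homogeneous functions $H_1,H_2,\dots$, with $H_0=1$ and $H_\alpha=H_{\alpha_1}\cdots H_{\alpha_k}$. The elementary functions $E_n$ are given by $E_0=1$ and $\sum_{i=0}^n(-1)^iE_iH_{n-i}=0$ for $n>0$. The pairing of quasisymmetric functions with $\mathrm{NSym}$ is the bilinear one with $\langle M_\alpha,H_\beta\rangle=\delta_{\alpha\beta}$. The row-strict immaculate functions are the elements $\mathcal{RI}_\alpha\in\mathrm{NSym}$ with $\langle\mathcal{R}\mathfrak{S}^*_\alpha,\mathcal{RI}_\beta\rangle=\delta_{\alpha\beta}$ for all compositions $\alpha,\beta$. *Coefficients.* For an integer vector $v$ put $\mathrm{sgn}(v)=(-1)^{|\{i:v_i<0\}|}$. For an integer $s\ge0$ and a composition $\alpha$ of length $k$, let $Z_{s,\alpha}$ be the set of all $v\in\mathbb{Z}^k$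 such that 1. $v_1+\cdots+v_k=s$ and $v_1+\cdots+v_i\le s$ for all $i<k$; 2. $\alpha_i-v_i\ge0$ for all $i$, and $\alpha_i-v_i=0$ for at most one $i$; 3. for all $1\le i\le k$, with $s_i=s-(v_1+\cdots+v_{i-1})$: if $\alpha_i>s_i$ then $0\le v_i\le s_i$; if $\alpha_i<s_i$ then $v_i<0$; if $\alpha_i=s_i$ then either $v_i<0$, or $v_i=\alpha_i$ and $v_{i+1}=\cdots=v_k=0$. For compositions $\alpha,\gamma$ with $|\alpha|-|\gamma|=s$ and $k=\ell(\alpha)$ define $c^\gamma_{s,\alpha}$ as follows. - If $\ell(\gamma)=k$, then $c^\gamma_{s,\alpha}=\mathrm{sgn}(\alpha-\gamma)$ if $\alpha-\gamma\in Z_{s,\alpha}$, and $0$ otherwise. - If $\ell(\gamma)=k-1$, let $1\le j\le k$ be smallest such that $\alpha_i=\gamma_{i-1}$ for all $j<i\le k$, and let $j\le r\le k$ be largest such that $\alpha_j<\alpha_{j+1}<\cdots<\alpha_r$. Put $u=(\alpha_1-\gamma_1,\dots,\alpha_{j-1}-\gamma_{j-1})$. Then $c^\gamma_{s,\alpha}=\mathrm{sgn}(u)$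 if $r-j$ is even and $(u,\alpha_j,0,\dots,0)\in Z_{s,\alpha}$, and $0$ otherwise. - Otherwise $c^\gamma_{s,\alpha}=0$. **Corollary (left Pieri rule for row-strict immaculate functions).** The family of row-strict immaculate functions exists and is unique, and for every integer $m>0$ and every composition $\alpha$, $$E_m\,\mathcal{RI}_\alpha=\sum_{\substack{\beta\vDash|\alpha|+m\\ \beta_1\ge m\\ 0\le\ell(\beta)-\ell(\alpha)\le1}}c^{\mathrm{tail}(\beta)}_{\beta_1-m,\,\alpha}\;\mathcal{RI}_\beta .$$ -/

import Mathlib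

/-! Compositions of `n` are Mathlib's `Composition n`.  Parts, positions, letters and rows are
numbered from `0` in the code; a subset of `[n-1] = {1, …, n-1}` is a `Finset (Fin (n - 1))`, where
`j : Fin (n - 1)` stands for the number `j + 1`. -/

namespace RowStrict

/-! ### Compositions and subsets -/

/-- The bijection between compositions `α ⊨ n` and subsets of `[n-1]`, sending `α` to
`set(α) = {α₁, α₁ + α₂, …, α₁ + ⋯ + α_{k-1}}`. -/
def setEquiv (n : ℕ) : Composition n ≃ Finset (Fin (n - 1)) :=
  (compositionEquiv n).trans (compositionAsSetEquiv n)

/-- `set(α)`. -/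
def setOf {n : ℕ} (α : Composition n) : Finset (Fin (n - 1)) := setEquiv n α

/-- `comp(S)`. -/
def compOf {n : ℕ} (S : Finset (Fin (n - 1))) : Composition n := (setEquiv n).symm S

/-! ### Quasisymmetric functions, as formal power series in `x₀, x₁, x₂, …` -/

/-- The monomial quasisymmetric function
`M_α = ∑_{i₁ < ⋯ < i_k} x_{i₁}^{α₁} ⋯ x_{i_k}^{α_k}`: the coefficient of `x^d` is the number of
strictly increasing sequences `i` with `x_{i₁}^{α₁} ⋯ x_{i_k}^{α_k} = x^d`. -/
noncomputable def monomialQSym (R : Type*) [CommRing R] {n : ℕ} (α : Composition n) :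
    MvPowerSeries ℕ R := fun d =>
  (Nat.card {i : Fin α.length → ℕ //
    StrictMono i ∧ ∑ j, Finsupp.single (i j) (α.blocksFun j) = d} : R)

/-- The fundamental quasisymmetric function
`F_α = ∑ x_{i₁} ⋯ x_{i_n}`, over `i₁ ≤ ⋯ ≤ i_n` such that `i_j = i_{j+1}` implies `j ∉ set(α)`:
the coefficient of `x^d` is the number of such sequences `i` with `x_{i₁} ⋯ x_{i_n} = x^d`. -/
noncomputable def fundamentalQSym (R : Type*) [CommRing R] {n : ℕ} (α : Composition n) :
    MvPowerSeries ℕ R := fun d =>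
  (Nat.card {i : Fin n → ℕ //
    Monotone i ∧
    (∀ j : Fin (n - 1), i ⟨j, by omega⟩ = i ⟨j + 1, by omega⟩ → j ∉ setOf α) ∧
    ∑ j, Finsupp.single (i j) 1 = d} : R)

/-! ### Standard immaculate tableaux -/

/-- The boxes of the diagram of `α`: pairs (row, column), row `0` being the bottom row. -/
abbrev Box {n : ℕ} (α : Composition n) : Type :=
  Σ r : Fin α.length, Fin (α.blocksFun r)

/-- A bijective filling `T` of the diagram of `α ⊨ n` (the entry `v + 1` of the usual convention
being `v : Fin n`) is a standard immaculate tableau if the leftmost column increases from bottom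
to top and every row increases from left to right. -/
def IsStandardImmaculate {n : ℕ} (α : Composition n) (T : Box α ≃ Fin n) : Prop :=
  (∀ b b' : Box α, b.2.val = 0 → b'.2.val = 0 → b.1 < b'.1 → T b < T b') ∧
  (∀ (r : Fin α.length) (c c' : Fin (α.blocksFun r)), c < c' → T ⟨r, c⟩ < T ⟨r, c'⟩)

/-- The descent set of `T`: the `i ∈ [n-1]` such that `i + 1` appears in a row strictly above the
row of `i`. -/
def descents {n : ℕ} {α : Composition n} (T : Box α ≃ Fin n) : Finset (Fin (n - 1)) :=
  {j | (T.symm ⟨j, by omega⟩).1 < (T.symm ⟨j + 1, by omega⟩).1}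

open Classical in
/-- The row-strict dual immaculate function `∑_T F_{comp(Des(T)ᶜ)}`, over all standard immaculate
tableaux `T` of shape `α`. -/
noncomputable def rowStrictDualImmaculate (R : Type*) [CommRing R] {n : ℕ} (α : Composition n) :
    MvPowerSeries ℕ R :=
  ∑ T : Box α ≃ Fin n with IsStandardImmaculate α T, fundamentalQSym R (compOf (descents T)ᶜ)

/-! ### Noncommutative symmetric functions -/

/-- The algebra `NSym` of noncommutative symmetric functions over `R`: the free associative algebra
on the complete homogeneous functions `H₁, H₂, …`. -/
abbrev NSym (R : Type*) [CommRing R] : Type _ := FreeAlgebra R ℕ+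

/-- The complete homogeneous noncommutative symmetric function `H_n`, with `H_0 = 1`. -/
noncomputable def complete (R : Type*) [CommRing R] (n : ℕ) : NSym R :=
  if h : 0 < n then FreeAlgebra.ι R (⟨n, h⟩ : ℕ+) else 1

/-- `H_α = H_{α₁} ⋯ H_{α_k}`. -/
noncomputable def completeComp (R : Type*) [CommRing R] {n : ℕ} (α : Composition n) : NSym R :=
  (α.blocks.map (complete R)).prod

/-- The elementary noncommutative symmetric function `E_n`, given by `E_0 = 1` and
`∑_{i=0}^{n} (-1)^i E_i H_{n-i} = 0` for `n > 0`. -/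
noncomputable def elementary (R : Type*) [CommRing R] : ℕ → NSym R
  | 0 => 1
  | n + 1 => ∑ i : Fin (n + 1),
      (-1 : NSym R) ^ (n - i.val) * elementary R i.val * complete R (n + 1 - i.val)

/-- The exponent of `x₀^{w₀} x₁^{w₁} ⋯ x_{k-1}^{w_{k-1}}`, for a word `w` of positive integers. -/
noncomputable def expo (w : FreeMonoid ℕ+) : ℕ →₀ ℕ :=
  ∑ j : Fin w.toList.length, Finsupp.single (j : ℕ) (w.toList[j] : ℕ)

/-- The bilinear pairing between quasisymmetric functions and `NSym` with
`⟨M_α, H_β⟩ = δ_{αβ}`: `⟨f, H_β⟩` is the coefficient of `x₀^{β₀} ⋯ x_{k-1}^{β_{k-1}}` in `f`, which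
for a quasisymmetric `f` is the coefficient of `M_β` in the expansion of `f` in the `M_α`. -/
noncomputable def pairing (R : Type*) [CommRing R] :
    MvPowerSeries ℕ R →ₗ[R] NSym R →ₗ[R] R :=
  ((FreeAlgebra.basisFreeMonoid R ℕ+).constr R).toLinearMap ∘ₗ
    LinearMap.pi fun w => MvPowerSeries.coeff (R := R) (expo w)

theorem expo_apply (w : FreeMonoid ℕ+) (t : ℕ) :
    expo w t = (w.toList.map (fun a : ℕ+ => (a : ℕ))).getD t 0 := by
  classical
  rw [expo, Finsupp.finsetSum_apply]
  by_cases ht : t < w.toList.length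
  · rw [Finset.sum_eq_single (⟨t, ht⟩ : Fin w.toList.length)]
    · simp [List.getD, ht]
    · intro b _ hb
      rw [Finsupp.single_eq_of_ne]
      exact fun h => hb (Fin.ext h.symm)
    · simp
  · rw [Finset.sum_eq_zero]
    · simp [List.getD, ht]
    · intro b _
      rw [Finsupp.single_eq_of_ne]
      exact fun h => ht (h ▸ b.2)

theorem basis_eq (R : Type*) [CommRing R] (w : FreeMonoid ℕ+) :
    FreeAlgebra.basisFreeMonoid R ℕ+ w = (w.toList.map (FreeAlgebra.ι R)).prod := by
  simp only [FreeAlgebra.basisFreeMonoid, Module.Basis.map_apply, Finsupp.coe_basisSingleOne]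
  have : FreeMonoid.lift (FreeAlgebra.ι R) w = (w.toList.map (FreeAlgebra.ι R)).prod := by
    rw [FreeMonoid.lift_apply]
  rw [← this]
  simp [FreeAlgebra.equivMonoidAlgebraFreeMonoid]

theorem exists_word {n : ℕ} (α : Composition n) :
    ∃ w : FreeMonoid ℕ+, w.toList.map (fun a : ℕ+ => (a : ℕ)) = α.blocks := by
  refine ⟨FreeMonoid.ofList (α.blocks.pmap (fun a h => Nat.toPNat a h)
    fun _ h => α.blocks_pos h), ?_⟩
  rw [FreeMonoid.toList_ofList, List.map_pmap]
  simp [Nat.toPNat]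

theorem sum_single_eq_iff {n : ℕ} (α : Composition n) (w : FreeMonoid ℕ+)
    (i : Fin α.length → ℕ) (hi : StrictMono i) :
    ∑ j, Finsupp.single (i j) (α.blocksFun j) = expo w ↔
      (w.toList.map (fun a : ℕ+ => (a : ℕ)) = α.blocks ∧ ∀ j, i j = j) := by
  classical
  constructor
  · intro h
    have h1 : ∀ j, expo w (i j) = α.blocksFun j := by
      intro j
      rw [← h, Finsupp.finsetSum_apply, Finset.sum_eq_single j]
      · simp
      · intro b _ hb
        rw [Finsupp.single_eq_of_ne]
        exact fun e => hb (hi.injective e.symm)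
      · simp
    have h2 : ∀ t, (∀ j, i j ≠ t) → expo w t = 0 := by
      intro t ht
      rw [← h, Finsupp.finsetSum_apply, Finset.sum_eq_zero]
      intro b _
      rw [Finsupp.single_eq_of_ne]
      exact fun e => ht b e.symm
    have h3 : Set.range i = Set.range (Fin.val : Fin w.toList.length → ℕ) := by
      ext t
      rw [Fin.range_val, Set.mem_Iio, Set.mem_range]
      constructor
      · rintro ⟨j, rfl⟩
        by_contra hc
        have := h1 j
        rw [expo_apply, List.getD_eq_default _ _ (by simpa using hc)] at this
        have := α.one_le_blocksFun j
        omega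
      · intro ht
        by_contra! hc
        have := h2 t hc
        rw [expo_apply, List.getD_eq_getElem _ _ (by simpa using ht)] at this
        simp at this
    have hk : α.length = w.toList.length := by
      have := congrArg Set.ncard h3
      rwa [Set.ncard_range_of_injective hi.injective,
        Set.ncard_range_of_injective Fin.val_injective, Nat.card_fin, Nat.card_fin] at this
    rw [← hk] at h3
    have h4 := (StrictMono.range_inj hi Fin.val_strictMono).1 h3
    subst h4
    refine ⟨List.ext_getElem (by simpa using hk.symm) fun t ht ht' => ?_, fun _ => rfl⟩
    have := h1 ⟨t, ht'⟩
    rw [expo_apply, List.getD_eq_getElem _ _ ht] at this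
    exact this
  · rintro ⟨hw, hij⟩
    ext t
    rw [expo_apply, hw, Finsupp.finsetSum_apply]
    by_cases ht : t < α.length
    · rw [Finset.sum_eq_single (⟨t, ht⟩ : Fin α.length)]
      · rw [hij, List.getD_eq_getElem _ _ ht]; simp [Composition.blocksFun]
      · intro b _ hb
        rw [Finsupp.single_eq_of_ne]
        exact fun e => hb (Fin.ext (by rw [hij] at e; exact e.symm))
      · simp
    · rw [Finset.sum_eq_zero, List.getD_eq_default _ _ (by simpa using ht)]
      intro b _
      rw [Finsupp.single_eq_of_ne]
      exact fun e => ht (by rw [e, hij]; exact b.2)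

/-- `⟨M_α, H_β⟩ = δ_{αβ}`. -/
theorem pairing_monomialQSym_completeComp (R : Type*) [CommRing R] {n k : ℕ}
    (α : Composition n) (β : Composition k) :
    pairing R (monomialQSym R α) (completeComp R β) = if α.blocks = β.blocks then 1 else 0 := by
  obtain ⟨w, hw⟩ := exists_word β
  have h1 : completeComp R β = FreeAlgebra.basisFreeMonoid R ℕ+ w := by
    rw [basis_eq, completeComp, ← hw, List.map_map]
    congr 2
    funext a
    simp only [Function.comp_apply, complete, dif_pos a.pos]
    rfl
  have h2 : pairing R (monomialQSym R α) (completeComp R β) =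
      MvPowerSeries.coeff (expo w) (monomialQSym R α) := by
    rw [h1]
    simp [pairing, Module.Basis.constr_basis]
  rw [h2]
  change ((Nat.card _ : ℕ) : R) = _
  split_ifs with hb
  · have : Nat.card {i : Fin α.length → ℕ // StrictMono i ∧
        ∑ j, Finsupp.single (i j) (α.blocksFun j) = expo w} = 1 := by
      rw [Nat.card_eq_one_iff_unique]
      refine ⟨⟨fun a b => Subtype.ext (funext fun j => ?_)⟩,
        ⟨⟨fun j => j, Fin.val_strictMono, ?_⟩⟩⟩
      · rw [((sum_single_eq_iff α w _ a.2.1).1 a.2.2).2,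
          ((sum_single_eq_iff α w _ b.2.1).1 b.2.2).2]
      · exact (sum_single_eq_iff α w _ Fin.val_strictMono).2 ⟨hw.trans hb.symm, fun _ => rfl⟩
    rw [this, Nat.cast_one]
  · have : IsEmpty {i : Fin α.length → ℕ // StrictMono i ∧
        ∑ j, Finsupp.single (i j) (α.blocksFun j) = expo w} :=
      ⟨fun a => hb (((sum_single_eq_iff α w _ a.2.1).1 a.2.2).1.symm.trans hw)⟩
    rw [Nat.card_of_isEmpty, Nat.cast_zero]

/-- A family `L_α ∈ NSym`, indexed by all compositions `α`, is dual to the row-strict dual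
immaculate functions. -/
def IsDualToRowStrict (R : Type*) [CommRing R] (L : (n : ℕ) → Composition n → NSym R) : Prop :=
  ∀ (n k : ℕ) (α : Composition n) (β : Composition k),
    pairing R (rowStrictDualImmaculate R α) (L k β) = if α.blocks = β.blocks then 1 else 0

/-! ### The coefficients of the left Pieri rule -/

/-- `sgn(v) = (-1)^{|{i : v_i < 0}|}`. -/
def sgn {k : ℕ} (v : Fin k → ℤ) : ℤ := (-1) ^ (Finset.univ.filter fun i => v i < 0).card

/-- Membership of `v ∈ ℤ^k` in the set `Z_{s,α}`, for a list `α` of length `k`. -/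
def InZ (s : ℤ) (α : List ℕ) (v : Fin α.length → ℤ) : Prop :=
  (∑ i, v i = s ∧ ∀ i : Fin α.length, i.val + 1 < α.length → ∑ t ∈ Finset.Iic i, v t ≤ s) ∧
  ((∀ i, 0 ≤ (α.get i : ℤ) - v i) ∧
    (Finset.univ.filter fun i : Fin α.length => (α.get i : ℤ) - v i = 0).card ≤ 1) ∧
  ∀ i : Fin α.length,
    ((α.get i : ℤ) > s - ∑ t ∈ Finset.Iio i, v t →
      0 ≤ v i ∧ v i ≤ s - ∑ t ∈ Finset.Iio i, v t) ∧
    ((α.get i : ℤ) < s - ∑ t ∈ Finset.Iio i, v t → v i < 0) ∧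
    ((α.get i : ℤ) = s - ∑ t ∈ Finset.Iio i, v t →
      v i < 0 ∨ (v i = (α.get i : ℤ) ∧ ∀ t, i < t → v t = 0))

instance (s : ℤ) (α : List ℕ) (v : Fin α.length → ℤ) : Decidable (InZ s α v) := by
  unfold InZ; infer_instance

/-- The index `j` (numbered from `0`): the smallest one such that `α_i = γ_{i-1}` for all `i` with
`j < i < ℓ(α)`. -/
def pieriJ (α γ : List ℕ) : ℕ :=
  Nat.find (p := fun j => ∀ i < α.length, j < i → α.getD i 0 = γ.getD (i - 1) 0)
    ⟨α.length, fun i hi hj => absurd hi (by omega)⟩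

/-- The index `r` (numbered from `0`): the largest one with `j ≤ r < ℓ(α)` and
`α_j < α_{j+1} < ⋯ < α_r`. -/
def pieriR (α γ : List ℕ) : ℕ :=
  Nat.findGreatest
    (fun r => pieriJ α γ ≤ r ∧ ∀ i < r, pieriJ α γ ≤ i → α.getD i 0 < α.getD (i + 1) 0)
    (α.length - 1)

/-- The coefficient `c^γ_{s,α}`, for the lists of parts of two compositions `α`, `γ`. -/
def pieriCoeff (s : ℤ) (α γ : List ℕ) : ℤ :=
  if γ.length = α.length then
    if InZ s α (fun i => (α.get i : ℤ) - γ.getD i 0) then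
      sgn (fun i : Fin α.length => (α.get i : ℤ) - γ.getD i 0)
    else 0
  else if γ.length + 1 = α.length then
    if Even (pieriR α γ - pieriJ α γ) ∧
        InZ s α (fun i =>
          if i.val < pieriJ α γ then (α.get i : ℤ) - γ.getD i 0
          else if i.val = pieriJ α γ then (α.get i : ℤ) else 0) then
      sgn (fun i : Fin (pieriJ α γ) => (α.getD i 0 : ℤ) - γ.getD i 0)
    else 0
  else 0

end RowStrict

namespace RowStrict

/-! ### The skewing homomorphism, its inverse, and their action on the E_n. -/

section Algebra

open Polynomial

variable (R : Type*) [CommRing R]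

/-! Write H(z), E(z) for the generating series, so E(-z)H(z) = 1. The algebra map D = ∑ t^s D_s
(`skew`) multiplies H(z) by 1 + tz, hence divides E(-z) by it; the inverse series ∑ t^i G_i
(`skewInv`) multiplies E(-z) by 1 + tz. Put B_a = ∑_i E_{a+i} G_i (`creation`). The row-strict
immaculate functions turn out to be RI_β = B_{β_1} ⋯ B_{β_k}(1).

Duality. Standardization turns the sum of fundamental functions into the generating function of
tableaux whose rows increase strictly and whose first column increases weakly. The bottom row of
such a tableau contains the smallest letter, and each other letter at most once. Deleting it gives a
recursion for the pairing: apply H_m x ↦ H_{m-1} D(x) (`firstRow`), take the coefficient of t^{α_1 -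
1}, and continue with the tail of α (`natCast_card_filling`, `pairing_rowStrictDualImmaculate`).
Since `firstRow` sends E_m x to t^{m-1} D(x) for m > 0, it sends B_b x to t^{b-1} x for b > 0, which
is biorthogonality (`dualFunctional_immaculate`). The RI_β also span (`immaculateSpan_eq_top`), so
the functionals separate points and the dual family is unique.

Pieri rule. By the same formula, the coefficient of RI_β in E_m RI_α is the pairing of tail(β) with
D_s RI_α, where s = β_1 - m. To compute it, move D_s past B_a. For s < a, D_s B_a = ∑_{p ≤ s}
B_{a-p} D_{s-p}; for s ≥ a, D_s B_a = E_{a-s} - ∑_{q ≥ 0} B_{a+q+1} D_{s+q+1}. Each form has only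
positive subscripts in its range, so a first part g can be read off: v_1 = a - g equals p or -(q+1).
This yields a recursion on the first parts of α and γ, and c^γ_{s,α} satisfies the same one: the
ranges of p and q are the inequalities of Z_{s,α}, the minus sign produces sgn, and the term E_0 = 1
at a = s accounts for ℓ(γ) = k - 1, where its overlap with the other term gives the parity of r - j.
-/

@[simp] theorem complete_zero : complete R 0 = 1 := by simp [complete]

theorem iota_eq_complete (m : ℕ+) : FreeAlgebra.ι R m = complete R m := by
  rw [complete, dif_pos m.pos]
  rfl

@[simp] theorem elementary_zero : elementary R 0 = 1 := by simp [elementary]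

theorem elementary_complete_sum (n : ℕ) :
    ∑ i ∈ Finset.range (n + 2),
      (-1 : NSym R) ^ i * elementary R i * complete R (n + 1 - i) = 0 := by
  rw [Finset.sum_range_succ, elementary, Finset.mul_sum, Finset.sum_mul,
    Finset.sum_range, ← Finset.sum_add_distrib]
  refine Finset.sum_eq_zero fun i _ => ?_
  have hi : (-1 : NSym R) ^ (n + 1) * (-1) ^ (n - i.val) = -(-1) ^ i.val := by
    rw [← pow_add]
    have : n + 1 + (n - i.val) = 2 * (n - i.val) + i.val + 1 := by omega
    rw [this, pow_succ, pow_add, pow_mul]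
    simp
  simp only [Nat.sub_self, complete_zero, mul_one]
  rw [← mul_assoc, ← mul_assoc, hi]
  simp

/-- A sequence `e` with prescribed alternating convolutions against `h` is unique. -/
theorem eq_of_convolution_eq {S : Type*} [Ring S] {e e' h : ℕ → S} (h0 : h 0 = 1)
    (he : ∀ n, ∑ i ∈ Finset.range (n + 1), (-1) ^ i * e i * h (n - i) =
      ∑ i ∈ Finset.range (n + 1), (-1) ^ i * e' i * h (n - i)) (n : ℕ) : e n = e' n := by
  induction n using Nat.strong_induction_on with
  | _ n ih =>
    have := he n
    rw [Finset.sum_range_succ, Finset.sum_range_succ, Finset.sum_congr rfl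
      (fun i hi => by rw [ih i (Finset.mem_range.1 hi)])] at this
    have := add_left_cancel this
    simp only [Nat.sub_self, h0, mul_one] at this
    have h2 := congrArg (fun x => (-1 : S) ^ n * x) this
    have h3 : (-1 : S) ^ n * (-1) ^ n = 1 := by
      rw [← pow_add, Even.neg_one_pow ⟨n, rfl⟩]
    simpa only [← mul_assoc, h3, one_mul] using h2

/-- The homomorphism `∑_s t^s D_s` with `H_m ↦ H_m + t H_{m-1}`. -/
noncomputable def skew : NSym R →ₐ[R] (NSym R)[X] :=
  FreeAlgebra.lift R fun m : ℕ+ => C (complete R m) + X * C (complete R (m - 1))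

@[simp] theorem skew_complete_succ (n : ℕ) :
    skew R (complete R (n + 1)) = C (complete R (n + 1)) + X * C (complete R n) := by
  have := iota_eq_complete R n.succPNat
  rw [Nat.succPNat_coe, Nat.succ_eq_add_one] at this
  rw [← this, skew, FreeAlgebra.lift_ι_apply, this]
  rfl

/-- `∑_i (-t)^i H_{n-i}`. -/
noncomputable def completeAlt : ℕ → (NSym R)[X]
  | 0 => 1
  | n + 1 => C (complete R (n + 1)) - X * completeAlt n

/-- The inverse `∑_s t^s G_s` of `skew` as a series of operators. -/
noncomputable def skewInv : NSym R →ₐ[R] (NSym R)[X] :=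
  FreeAlgebra.lift R fun m : ℕ+ => completeAlt R m

@[simp] theorem skewInv_complete (n : ℕ) : skewInv R (complete R n) = completeAlt R n := by
  rcases n with _ | n
  · simp [completeAlt]
  have := iota_eq_complete R n.succPNat
  rw [Nat.succPNat_coe, Nat.succ_eq_add_one] at this
  rw [← this, skewInv, FreeAlgebra.lift_ι_apply]
  rfl

theorem convolution_map {S : Type*} [Ring S] {F : Type*} [FunLike F (NSym R) S]
    [RingHomClass F (NSym R) S] (f : F) (n : ℕ) :
    ∑ i ∈ Finset.range (n + 2), (-1) ^ i * f (elementary R i) * f (complete R (n + 1 - i)) = 0 := by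
  simpa using congrArg f (elementary_complete_sum R n)

/-- Multiplying `h` by `1 + tz` and dividing `e(-z)` by it does not change `e(-z) h(z)`. -/
theorem convolution_eq {S : Type*} [Ring S] {t : S} (ht : ∀ x, t * x = x * t)
    {e e' h h' : ℕ → S} (he0 : e' 0 = e 0) (hh0 : h' 0 = h 0)
    (he : ∀ n, e' (n + 1) = e (n + 1) + t * e' n) (hh : ∀ n, h' (n + 1) = h (n + 1) + t * h n)
    (n : ℕ) :
    ∑ i ∈ Finset.range (n + 1), (-1) ^ i * e' i * h' (n - i) =
      ∑ i ∈ Finset.range (n + 1), (-1) ^ i * e i * h (n - i) := by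
  rcases n with _ | n
  · simp [he0, hh0]
  rw [Finset.sum_range_succ]
  have h1 : ∀ i ∈ Finset.range (n + 1), (-1) ^ i * e' i * h' (n + 1 - i) =
      (-1) ^ i * e' i * h (n + 1 - i) + (-1) ^ i * (t * e' i) * h (n - i) := by
    intro i hi
    have : n + 1 - i = (n - i) + 1 := by have := Finset.mem_range.1 hi; omega
    rw [this, hh, mul_add, ht (e' i)]
    simp only [mul_assoc]
  have h3 : ∑ i ∈ Finset.range (n + 1), (-1) ^ i * e' i * h (n + 1 - i) +
      (-1) ^ (n + 1) * e' (n + 1) * h' (n + 1 - (n + 1)) =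
      ∑ i ∈ Finset.range (n + 2), (-1) ^ i * e' i * h (n + 1 - i) := by
    rw [Finset.sum_range_succ _ (n + 1), Nat.sub_self, hh0]
  rw [Finset.sum_congr rfl h1, Finset.sum_add_distrib, add_right_comm, h3,
    Finset.sum_range_succ', add_right_comm, ← Finset.sum_add_distrib,
    Finset.sum_range_succ' (fun i => (-1) ^ i * e i * h (n + 1 - i)), he0]
  congr 1
  refine Finset.sum_congr rfl fun i _ => ?_
  rw [Nat.add_sub_add_right, he, pow_succ]
  noncomm_ring

/-- The sequence solving this recursion has the series E(-z)/(1+tz). Its product with (1+tz)H(z) is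
again 1, so `eq_of_convolution_eq` identifies it with the image of E. -/
theorem skew_elementary_succ (n : ℕ) :
    skew R (elementary R (n + 1)) = C (elementary R (n + 1)) + X * skew R (elementary R n) := by
  let e' : ℕ → (NSym R)[X] := fun n =>
    Nat.rec 1 (fun n e => C (elementary R (n + 1)) + X * e) n
  have key : ∀ n, skew R (elementary R n) = e' n := by
    refine eq_of_convolution_eq (h := fun n => skew R (complete R n)) (by simp) fun n => ?_
    rw [convolution_eq (t := X) (e := fun n => C (elementary R n)) (e' := e')
      (h := fun n => C (complete R n)) (h' := fun n => skew R (complete R n))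
      (fun x => X_mul) (by simp [e']) (by simp) (fun _ => rfl)
      (fun n => skew_complete_succ R n)]
    rcases n with _ | n
    · simp
    rw [convolution_map R (skew R) n, convolution_map R (C : NSym R →+* (NSym R)[X]) n]
  rw [key, key]

/-- The argument of `skew_elementary_succ` with the roles exchanged: here E and H are the primed
sequences of `convolution_eq`, obtained from the candidate e' and from the image of H. -/
theorem skewInv_elementary_succ (n : ℕ) :
    skewInv R (elementary R (n + 1)) =
      C (elementary R (n + 1)) - X * C (elementary R n) := by
  let e' : ℕ → (NSym R)[X] := fun n =>
    Nat.casesOn n 1 (fun n => C (elementary R (n + 1)) - X * C (elementary R n))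
  have key : ∀ n, skewInv R (elementary R n) = e' n := by
    refine eq_of_convolution_eq (h := fun n => skewInv R (complete R n)) (by simp) fun n => ?_
    rw [← convolution_eq (t := X) (e' := fun n => C (elementary R n)) (e := e')
      (h' := fun n => C (complete R n)) (h := fun n => skewInv R (complete R n))
      (fun x => X_mul) (by simp [e']) (by simp) (fun _ => by simp [e']) (fun n => by
        rw [skewInv_complete, skewInv_complete, completeAlt]; simp)]
    rcases n with _ | n
    · simp
    rw [convolution_map R (skewInv R) n, convolution_map R (C : NSym R →+* (NSym R)[X]) n]
  rw [key]

/-! ### Induction on left multiplication -/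

theorem complete_mem_adjoin (n : ℕ) :
    complete R n ∈ Algebra.adjoin R (Set.range fun m : ℕ => elementary R (m + 1)) := by
  induction n using Nat.strong_induction_on with
  | _ n ih =>
    rcases n with _ | n
    · simp [one_mem]
    have h := elementary_complete_sum R n
    rw [Finset.sum_range_succ'] at h
    simp only [pow_zero, elementary_zero, mul_one, Nat.sub_zero, one_mul] at h
    rw [eq_neg_of_add_eq_zero_right h]
    refine neg_mem (sum_mem fun i hi => mul_mem (mul_mem ?_ ?_) (ih _ (by omega)))
    · exact pow_mem (neg_mem (one_mem _)) _
    · exact Algebra.subset_adjoin ⟨i, rfl⟩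

/-- Allows inductions on left multiplication by E_m, for which the operators D_s, G_i and B_a have
short commutation rules. -/
theorem adjoin_elementary :
    Algebra.adjoin R (Set.range fun m : ℕ => elementary R (m + 1)) = ⊤ := by
  rw [eq_top_iff, ← FreeAlgebra.adjoin_range_ι, Algebra.adjoin_le_iff]
  rintro _ ⟨m, rfl⟩
  rw [iota_eq_complete]
  exact complete_mem_adjoin R m

variable {R}

/-- The elements a with aV ⊆ V form a subalgebra, so they are everything; apply this to 1 ∈ V. -/
theorem mem_of_mul_mem {s : Set (NSym R)} (hs : Algebra.adjoin R s = ⊤)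
    (V : Submodule R (NSym R)) (h1 : 1 ∈ V)
    (hV : ∀ a ∈ s, ∀ x ∈ V, a * x ∈ V) (x : NSym R) : x ∈ V := by
  let S : Subalgebra R (NSym R) :=
    { carrier := {a | ∀ x ∈ V, a * x ∈ V}
      mul_mem' := fun ha hb x hx => by rw [mul_assoc]; exact ha _ (hb _ hx)
      add_mem' := fun ha hb x hx => by rw [add_mul]; exact V.add_mem (ha _ hx) (hb _ hx)
      algebraMap_mem' := fun r x hx => by
        rw [← Algebra.smul_def]; exact V.smul_mem _ hx }
  have : (⊤ : Subalgebra R (NSym R)) ≤ S := by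
    rw [← hs, Algebra.adjoin_le_iff]
    exact hV
  simpa using this (Algebra.mem_top : x ∈ _) 1 h1

theorem linearMap_ext_elementary {M : Type*} [AddCommGroup M] [Module R M]
    {f g : NSym R →ₗ[R] M} (h1 : f 1 = g 1)
    (h : ∀ m x, f x = g x → f (elementary R (m + 1) * x) = g (elementary R (m + 1) * x)) :
    f = g := by
  ext x
  refine mem_of_mul_mem (adjoin_elementary R) (LinearMap.eqLocus f g) h1 ?_ x
  rintro _ ⟨m, rfl⟩ x hx
  exact h m x hx

end Algebra

/-! ### Creation operators and their commutation with skewing. -/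

section Creation

open Polynomial

variable (R : Type*) [CommRing R]

/-- `E_m` for an integer `m`, zero if `m < 0`. -/
noncomputable def elementaryInt : ℤ → NSym R
  | .ofNat n => elementary R n
  | .negSucc _ => 0

@[simp] theorem elementaryInt_natCast (n : ℕ) : elementaryInt R n = elementary R n := rfl

theorem elementaryInt_of_neg {m : ℤ} (hm : m < 0) : elementaryInt R m = 0 := by
  cases m with
  | ofNat n => exact absurd hm (by simp)
  | negSucc n => rfl

@[simp] theorem elementaryInt_zero : elementaryInt R 0 = 1 := by
  simpa using elementaryInt_natCast R 0

variable {R}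

/-- With E_m = 0 for m < 0 the recursion persists for every integer m, so the sums defining B_a need
no case distinction. -/
theorem skew_elementaryInt_mul (m : ℤ) (x : NSym R) :
    skew R (elementaryInt R m * x) =
      C (elementaryInt R m) * skew R x + X * skew R (elementaryInt R (m - 1) * x) := by
  rcases lt_trichotomy m 0 with h | rfl | h
  · rw [elementaryInt_of_neg R h, elementaryInt_of_neg R (by omega)]; simp
  · rw [elementaryInt_of_neg R (m := 0 - 1) (by omega)]; simp
  · obtain ⟨n, rfl⟩ : ∃ n : ℕ, m = (n + 1 : ℕ) := ⟨(m - 1).toNat, by omega⟩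
    have : ((n + 1 : ℕ) : ℤ) - 1 = n := by push_cast; ring
    rw [this, elementaryInt_natCast, elementaryInt_natCast, map_mul, skew_elementary_succ,
      map_mul]
    simp only [add_mul, mul_assoc]

theorem skewInv_elementaryInt_mul (m : ℤ) (x : NSym R) :
    skewInv R (elementaryInt R m * x) =
      C (elementaryInt R m) * skewInv R x - X * (C (elementaryInt R (m - 1)) * skewInv R x) := by
  rcases lt_trichotomy m 0 with h | rfl | h
  · rw [elementaryInt_of_neg R h, elementaryInt_of_neg R (by omega)]; simp
  · rw [elementaryInt_of_neg R (m := 0 - 1) (by omega)]; simp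
  · obtain ⟨n, rfl⟩ : ∃ n : ℕ, m = (n + 1 : ℕ) := ⟨(m - 1).toNat, by omega⟩
    have : ((n + 1 : ℕ) : ℤ) - 1 = n := by push_cast; ring
    rw [this, elementaryInt_natCast, elementaryInt_natCast, map_mul, skewInv_elementary_succ]
    simp only [sub_mul, mul_assoc]

/-- Apply `f` to the coefficients and collect the resulting polynomials in the same variable. -/
noncomputable def collect (f : NSym R →ₐ[R] (NSym R)[X]) : (NSym R)[X] →+* (NSym R)[X] :=
  eval₂RingHom' (f : NSym R →+* (NSym R)[X]) X fun a => (commute_X (f a)).symm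

@[simp] theorem collect_C (f : NSym R →ₐ[R] (NSym R)[X]) (a : NSym R) :
    collect f (C a) = f a := by
  exact eval₂_C _ _

@[simp] theorem collect_X (f : NSym R →ₐ[R] (NSym R)[X]) : collect f X = X := by
  exact eval₂_X _ _

/-- On generators this is (1+tz)(1+tz)⁻¹ = 1, that is, the recursion defining `completeAlt`.
Collecting both series in the same variable is multiplicative because `X` is central. -/
theorem collect_skewInv_skew (x : NSym R) : collect (skewInv R) (skew R x) = C x := by
  let V : Submodule R (NSym R) :=
    { carrier := {x | collect (skewInv R) (skew R x) = C x}
      zero_mem' := by simp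
      add_mem' := fun ha hb => by
        simp only [Set.mem_ofPred_eq] at *
        simp [ha, hb]
      smul_mem' := fun r x hx => by
        simp only [Set.mem_ofPred_eq] at *
        rw [Algebra.smul_def, map_mul, map_mul, hx, C_mul, AlgHom.commutes]
        congr 1
        rw [Polynomial.algebraMap_apply, collect_C, AlgHom.commutes,
          Polynomial.algebraMap_apply] }
  refine mem_of_mul_mem (FreeAlgebra.adjoin_range_ι R ℕ+) V (by simp [V]) ?_ x
  rintro _ ⟨m, rfl⟩ x hx
  obtain ⟨k, hk⟩ : ∃ k : ℕ, (m : ℕ) = k + 1 := ⟨m - 1, by have := m.pos; omega⟩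
  rw [iota_eq_complete, hk]
  change collect (skewInv R) (skew R x) = C x at hx
  change collect (skewInv R) (skew R _) = C _
  simp [hx, completeAlt, X_mul]

theorem collect_skew_skewInv (x : NSym R) : collect (skew R) (skewInv R x) = C x := by
  let V : Submodule R (NSym R) :=
    { carrier := {x | collect (skew R) (skewInv R x) = C x}
      zero_mem' := by simp
      add_mem' := fun ha hb => by
        simp only [Set.mem_ofPred_eq] at *
        simp [ha, hb]
      smul_mem' := fun r x hx => by
        simp only [Set.mem_ofPred_eq] at *
        rw [Algebra.smul_def, map_mul, map_mul, hx, C_mul, AlgHom.commutes]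
        congr 1
        rw [Polynomial.algebraMap_apply, collect_C, AlgHom.commutes,
          Polynomial.algebraMap_apply] }
  have h : ∀ n, collect (skew R) (completeAlt R n) = C (complete R n) := by
    intro n
    induction n with
    | zero => simp [completeAlt]
    | succ n ih => simp [completeAlt, ih]
  refine mem_of_mul_mem (FreeAlgebra.adjoin_range_ι R ℕ+) V (by simp [V]) ?_ x
  rintro _ ⟨m, rfl⟩ x hx
  change collect (skew R) (skewInv R x) = C x at hx
  change collect (skew R) (skewInv R _) = C _
  rw [iota_eq_complete, map_mul, map_mul, skewInv_complete, hx, h, C_mul]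

/-- The operator `D_s`: the coefficient of `t^s` in `skew`. -/
noncomputable def skewCoeff (s : ℕ) : NSym R →ₗ[R] NSym R :=
  ((lcoeff (NSym R) s).restrictScalars R).comp (skew R).toLinearMap

theorem skewCoeff_apply (s : ℕ) (x : NSym R) : skewCoeff s x = (skew R x).coeff s := rfl

/-- The operator `G_s`: the coefficient of `t^s` in `skewInv`. -/
noncomputable def skewInvCoeff (s : ℕ) : NSym R →ₗ[R] NSym R :=
  ((lcoeff (NSym R) s).restrictScalars R).comp (skewInv R).toLinearMap

theorem skewInvCoeff_apply (s : ℕ) (x : NSym R) : skewInvCoeff s x = (skewInv R x).coeff s := rfl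

theorem skewCoeff_one (s : ℕ) : skewCoeff s (1 : NSym R) = if s = 0 then 1 else 0 := by
  rw [skewCoeff_apply, map_one, coeff_one]

theorem skewInvCoeff_one (s : ℕ) : skewInvCoeff s (1 : NSym R) = if s = 0 then 1 else 0 := by
  rw [skewInvCoeff_apply, map_one, coeff_one]

theorem skewCoeff_zero_elementaryInt_mul (m : ℤ) (x : NSym R) :
    skewCoeff 0 (elementaryInt R m * x) = elementaryInt R m * skewCoeff 0 x := by
  rw [skewCoeff_apply, skew_elementaryInt_mul]; simp [skewCoeff_apply]

theorem skewCoeff_succ_elementaryInt_mul (s : ℕ) (m : ℤ) (x : NSym R) :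
    skewCoeff (s + 1) (elementaryInt R m * x) =
      elementaryInt R m * skewCoeff (s + 1) x + skewCoeff s (elementaryInt R (m - 1) * x) := by
  rw [skewCoeff_apply, skew_elementaryInt_mul]; simp [skewCoeff_apply]

theorem skewInvCoeff_zero_elementaryInt_mul (m : ℤ) (x : NSym R) :
    skewInvCoeff 0 (elementaryInt R m * x) = elementaryInt R m * skewInvCoeff 0 x := by
  rw [skewInvCoeff_apply, skewInv_elementaryInt_mul]; simp [skewInvCoeff_apply]

theorem skewInvCoeff_succ_elementaryInt_mul (s : ℕ) (m : ℤ) (x : NSym R) :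
    skewInvCoeff (s + 1) (elementaryInt R m * x) =
      elementaryInt R m * skewInvCoeff (s + 1) x -
        elementaryInt R (m - 1) * skewInvCoeff s x := by
  rw [skewInvCoeff_apply, skewInv_elementaryInt_mul]; simp [skewInvCoeff_apply]

theorem skewCoeff_zero (x : NSym R) : skewCoeff 0 x = x := by
  suffices h : skewCoeff 0 = (LinearMap.id : NSym R →ₗ[R] NSym R) by rw [h]; rfl
  refine linearMap_ext_elementary (by simp [skewCoeff_one]) fun m x hx => ?_
  rw [← elementaryInt_natCast, skewCoeff_zero_elementaryInt_mul, hx]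
  rfl

/-- Both maps scale H(z) by a series with central coefficients, so they commute. In the induction,
D_{s+1}(E_m x) involves D_s(E_{m-1} x), hence the inner induction on m. -/
theorem skewCoeff_skewInvCoeff (s i : ℕ) (x : NSym R) :
    skewCoeff s (skewInvCoeff i x) = skewInvCoeff i (skewCoeff s x) := by
  let V : Submodule R (NSym R) :=
    { carrier := {x | ∀ s i, skewCoeff s (skewInvCoeff i x) = skewInvCoeff i (skewCoeff s x)}
      zero_mem' := by simp
      add_mem' := fun ha hb s i => by
        simp only [map_add, ha s i, hb s i]
      smul_mem' := fun r x hx s i => by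
        simp only [map_smul, hx s i] }
  have key : ∀ x ∈ V, ∀ m : ℕ, elementaryInt R m * x ∈ V := by
    intro x hx m
    induction m with
    | zero => simpa using hx
    | succ m ih =>
      intro s i
      have h1 : ((m + 1 : ℕ) : ℤ) - 1 = m := by push_cast; ring
      rcases s with _ | s
      · simp only [skewCoeff_zero]
      · rcases i with _ | i
        · have := ih s 0
          rw [skewInvCoeff_zero_elementaryInt_mul] at this
          rw [skewInvCoeff_zero_elementaryInt_mul, skewCoeff_succ_elementaryInt_mul,
            skewCoeff_succ_elementaryInt_mul, map_add, skewInvCoeff_zero_elementaryInt_mul,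
            hx, h1, this]
        · have := ih s (i + 1)
          rw [skewInvCoeff_succ_elementaryInt_mul, map_sub] at this
          rw [skewInvCoeff_succ_elementaryInt_mul, skewCoeff_succ_elementaryInt_mul, map_sub,
            map_add, skewInvCoeff_succ_elementaryInt_mul, skewCoeff_succ_elementaryInt_mul,
            skewCoeff_succ_elementaryInt_mul, hx, hx, h1, ← this]
          abel
  refine mem_of_mul_mem (adjoin_elementary R) V (fun s i => ?_) ?_ x s i
  · simp only [skewCoeff_one, skewInvCoeff_one]
    split_ifs <;> simp [*, skewCoeff_one, skewInvCoeff_one]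
  · rintro _ ⟨m, rfl⟩ x hx
    exact key x hx (m + 1)

/-- `∑ c_i t^i ↦ ∑ E_{a+i} c_i`. -/
noncomputable def elementaryEval (a : ℤ) : (NSym R)[X] →ₗ[R] NSym R :=
  lsum fun i => LinearMap.mulLeft R (elementaryInt R (a + i))

theorem elementaryEval_apply (a : ℤ) (p : (NSym R)[X]) :
    elementaryEval a p = p.sum fun i c => elementaryInt R (a + i) * c := rfl

theorem elementaryEval_eq_sum (a : ℤ) (p : (NSym R)[X]) {N : ℕ} (hN : p.natDegree < N) :
    elementaryEval a p = ∑ i ∈ Finset.range N, elementaryInt R (a + i) * p.coeff i := by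
  rw [elementaryEval_apply, sum_over_range' _ (by simp) _ hN]

theorem elementaryEval_X_mul (a : ℤ) (p : (NSym R)[X]) :
    elementaryEval a (X * p) = elementaryEval (a + 1) p := by
  have h : (X * p).natDegree < p.natDegree + 2 := by
    have := natDegree_mul_le (p := (X : (NSym R)[X])) (q := p)
    have := natDegree_X_le (R := NSym R)
    omega
  rw [elementaryEval_eq_sum a _ h, Finset.sum_range_succ',
    elementaryEval_eq_sum (a + 1) p (N := p.natDegree + 1) (by omega)]
  simp [add_right_comm a, add_assoc]

theorem elementaryEval_X_pow_mul (a : ℤ) (n : ℕ) (p : (NSym R)[X]) :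
    elementaryEval a (X ^ n * p) = elementaryEval (a + n) p := by
  induction n generalizing a with
  | zero => simp
  | succ n ih =>
    rw [pow_succ', mul_assoc, elementaryEval_X_mul, ih]
    rw [add_assoc, Nat.cast_succ, add_comm 1 (n : ℤ)]

theorem elementaryEval_C (a : ℤ) (x : NSym R) :
    elementaryEval a (C x) = elementaryInt R a * x := by
  rw [elementaryEval_apply, sum_C_index] <;> simp

/-- The creation operator `B_a = ∑_i E_{a+i} G_i`. -/
noncomputable def creation (a : ℤ) : NSym R →ₗ[R] NSym R :=
  (elementaryEval a).comp (skewInv R).toLinearMap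

theorem creation_eq_sum (a : ℤ) (x : NSym R) {N : ℕ} (hN : (skewInv R x).natDegree < N) :
    creation a x = ∑ i ∈ Finset.range N, elementaryInt R (a + i) * skewInvCoeff i x :=
  elementaryEval_eq_sum a _ hN

/-- The left side is ∑ E_{a+q+i} G_i D_q x, and ∑_{i+q=n} G_i D_q vanishes unless n = 0, the two
series being inverse. -/
theorem sum_creation_skewCoeff (a : ℤ) (x : NSym R) {N : ℕ} (hN : (skew R x).natDegree < N) :
    ∑ q ∈ Finset.range N, creation (a + q) (skewCoeff q x) = elementaryInt R a * x := by
  rw [← elementaryEval_C, ← collect_skewInv_skew]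
  conv_rhs => rw [as_sum_range' (skew R x) N hN]
  rw [map_sum, map_sum]
  refine Finset.sum_congr rfl fun q _ => ?_
  rw [← C_mul_X_pow_eq_monomial, map_mul, map_pow, collect_X, collect_C, ← X_pow_mul,
    elementaryEval_X_pow_mul]
  rfl

/-- Apply the rule for D_{s+1}(E_m y) to each term E_{a+i} G_i x: D_{s+1} passes through G_i, and
lowering every index of E turns B_a into B_{a-1}. -/
theorem skewCoeff_succ_creation (s : ℕ) (a : ℤ) (x : NSym R) :
    skewCoeff (s + 1) (creation a x) =
      creation a (skewCoeff (s + 1) x) + skewCoeff s (creation (a - 1) x) := by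
  obtain ⟨N, h1, h2⟩ : ∃ N, (skewInv R x).natDegree < N ∧
      (skewInv R (skewCoeff (s + 1) x)).natDegree < N :=
    ⟨(skewInv R x).natDegree + (skewInv R (skewCoeff (s + 1) x)).natDegree + 1,
      by omega, by omega⟩
  rw [creation_eq_sum a x h1, creation_eq_sum a _ h2, creation_eq_sum (a - 1) x h1, map_sum,
    map_sum, ← Finset.sum_add_distrib]
  refine Finset.sum_congr rfl fun i _ => ?_
  rw [skewCoeff_succ_elementaryInt_mul, skewCoeff_skewInvCoeff]
  congr 4
  omega

theorem skewCoeff_creation (s : ℕ) (a : ℤ) (x : NSym R) :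
    skewCoeff s (creation a x) =
      ∑ p ∈ Finset.range (s + 1), creation (a - p) (skewCoeff (s - p) x) := by
  induction s generalizing a with
  | zero => simp [skewCoeff_zero]
  | succ s ih =>
    rw [skewCoeff_succ_creation, ih, Finset.sum_range_succ' _ (s + 1), add_comm]
    simp [sub_sub, add_comm]

/-- Complements `skewCoeff_creation`, whose subscripts a - p may fail to be positive once s ≥ a. The
case s = 0 is `sum_creation_skewCoeff`; each further step trades D_{s+1} B_a for D_s B_{a-1}. -/
theorem skewCoeff_creation_add (s : ℕ) (a : ℤ) (x : NSym R) {N : ℕ}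
    (hN : (skew R x).natDegree < N) :
    skewCoeff s (creation a x) +
      ∑ q ∈ Finset.range N, creation (a + q + 1) (skewCoeff (s + q + 1) x) =
      elementaryInt R (a - s) * x := by
  induction s generalizing a with
  | zero =>
    have h := sum_creation_skewCoeff a x (N := N + 1) (by omega)
    rw [Finset.sum_range_succ'] at h
    rw [Nat.cast_zero, sub_zero, ← h, add_comm]
    simp [skewCoeff_zero, add_assoc]
  | succ s ih =>
    rw [skewCoeff_succ_creation]
    have h := ih (a - 1)
    have h0 : a - 1 - (s : ℤ) = a - (s + 1 : ℕ) := by push_cast; ring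
    rw [h0] at h
    rw [← h, add_comm (creation a _), add_assoc]
    congr 1
    have h2 : ∀ q : ℕ, creation (a - 1 + q + 1) (skewCoeff (s + q + 1) x) =
        creation (a + q) (skewCoeff (s + 1 + q) x) := by
      intro q
      congr 2
      · omega
      · rw [add_right_comm]
    simp only [h2]
    -- The extra term q = N is zero, since s + 1 + N exceeds the degree of `skew R x`.
    have h3 : ∑ q ∈ Finset.range (N + 1), creation (a + q) (skewCoeff (s + 1 + q) x) =
        ∑ q ∈ Finset.range N, creation (a + q) (skewCoeff (s + 1 + q) x) := by
      rw [Finset.sum_range_succ, skewCoeff_apply (s + 1 + N),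
        coeff_eq_zero_of_natDegree_lt (by omega), map_zero, add_zero]
    rw [← h3, Finset.sum_range_succ', add_comm]
    simp [add_assoc]

end Creation

/-! ### The dual functionals, biorthogonality and spanning. -/

section Duality

open Polynomial

variable (R : Type*) [CommRing R]

/-- The map with `1 ↦ 0` and `H_m x ↦ H_{m-1} D(x)`. -/
noncomputable def firstRow : NSym R →ₗ[R] (NSym R)[X] :=
  (FreeAlgebra.basisFreeMonoid R ℕ+).constr R fun w =>
    match w.toList with
    | [] => 0
    | m :: l => C (complete R (m - 1)) * skew R (l.map (FreeAlgebra.ι R)).prod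

variable {R}

theorem firstRow_word (w : FreeMonoid ℕ+) :
    firstRow R (w.toList.map (FreeAlgebra.ι R)).prod =
    match w.toList with
    | [] => 0
    | m :: l => C (complete R (m - 1)) * skew R (l.map (FreeAlgebra.ι R)).prod := by
  rw [← basis_eq, firstRow, Module.Basis.constr_basis]

theorem firstRow_one : firstRow R 1 = 0 := by
  simpa using firstRow_word (R := R) 1

theorem firstRow_complete_mul (n : ℕ) (x : NSym R) :
    firstRow R (complete R (n + 1) * x) = C (complete R n) * skew R x := by
  suffices h : (firstRow R).comp (LinearMap.mulLeft R (complete R (n + 1))) =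
      (LinearMap.mulLeft R (C (complete R n))).comp (skew R).toLinearMap from
    LinearMap.congr_fun h x
  refine (FreeAlgebra.basisFreeMonoid R ℕ+).ext fun w => ?_
  have h := firstRow_word (R := R) (FreeMonoid.of n.succPNat * w)
  have h2 := iota_eq_complete R n.succPNat
  rw [Nat.succPNat_coe, Nat.succ_eq_add_one] at h2
  simp only [FreeMonoid.toList_mul, FreeMonoid.toList_of, List.singleton_append, List.map_cons,
    List.prod_cons, h2] at h
  rw [basis_eq]
  exact h

theorem map_neg_one_pow_mul {S T : Type*} [Ring S] [Ring T] (f : S →+ T) (i : ℕ) (x : S) :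
    f ((-1) ^ i * x) = (-1) ^ i * f x := by
  obtain h | h := i.even_or_odd
  · rw [h.neg_one_pow, h.neg_one_pow, one_mul, one_mul]
  · rw [h.neg_one_pow, h.neg_one_pow, neg_one_mul, neg_one_mul, map_neg]

theorem alternating_telescope {S : Type*} [Ring S] {t : S} {h d : ℕ → S}
    (hd : ∀ n, d (n + 1) = h (n + 1) + t * h n) {n k : ℕ} (hk : k ≤ n) :
    h n + ∑ j ∈ Finset.range k, (-1) ^ (j + 1) * (t ^ j * d (n - j)) =
      (-1) ^ k * (t ^ k * h (n - k)) := by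
  induction k with
  | zero => simp
  | succ k ih =>
    have : n - k = (n - (k + 1)) + 1 := by omega
    rw [Finset.sum_range_succ, ← add_assoc, ih (by omega), this, hd, pow_succ, pow_succ, mul_add,
      ← mul_assoc (t ^ k) t]
    simp only [mul_neg, neg_mul, mul_one, mul_add]
    abel

theorem eq_of_neg_one_pow_mul_add_eq_zero {S : Type*} [Ring S] {n : ℕ} {a b : S}
    (h : (-1) ^ n * a + (-1) ^ (n + 1) * b = 0) : b = a := by
  rw [pow_succ, mul_neg_one, neg_mul, add_neg_eq_zero] at h
  obtain h' | h' := n.even_or_odd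
  · rw [h'.neg_one_pow, one_mul, one_mul] at h
    exact h.symm
  · rw [h'.neg_one_pow, neg_one_mul, neg_one_mul, neg_inj] at h
    exact h.symm

/-- Apply `firstRow` to (∑ (-1)^i E_i H_{n+1-i}) x = 0. The term i = 0 gives H_n D(x), and those
with 1 ≤ i ≤ n give ±t^{i-1} D(H_{n+1-i}) D(x) by induction. As D(H_{j+1}) = H_{j+1} + t H_j, these
telescope to ±t^n D(x), which the last term must cancel. -/
theorem firstRow_elementary_mul (n : ℕ) (x : NSym R) :
    firstRow R (elementary R (n + 1) * x) = X ^ n * skew R x := by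
  induction n using Nat.strong_induction_on generalizing x with
  | _ n ih =>
    have h := elementary_complete_sum R n
    rw [Finset.sum_range_succ, Finset.sum_range_succ'] at h
    have h2 := congrArg (fun y => firstRow R (y * x)) h
    have hneg : ∀ i y, firstRow R ((-1) ^ i * y) = (-1) ^ i * firstRow R y :=
      map_neg_one_pow_mul (firstRow R).toAddMonoidHom
    simp only [add_mul, Finset.sum_mul, map_add, map_sum, zero_mul, map_zero] at h2
    have h3 : ∀ j ∈ Finset.range n, firstRow R
        ((-1) ^ (j + 1) * elementary R (j + 1) * complete R (n + 1 - (j + 1)) * x) =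
        (-1) ^ (j + 1) * (X ^ j * skew R (complete R (n - j))) * skew R x := by
      intro j hj
      rw [mul_assoc, mul_assoc, hneg, ih j (Finset.mem_range.1 hj), map_mul,
        Nat.add_sub_add_right]
      simp only [mul_assoc]
    have h4 := alternating_telescope (t := X) (h := fun n => C (complete R n))
      (d := fun n => skew R (complete R n)) (skew_complete_succ R)
      (le_refl n)
    rw [Finset.sum_congr rfl h3, ← Finset.sum_mul, pow_zero, elementary_zero, one_mul, one_mul,
      Nat.sub_zero, firstRow_complete_mul, ← add_mul, add_comm _ (C _), h4,
      Nat.sub_self, Nat.sub_self, complete_zero, C_1, mul_one,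
      mul_one, mul_assoc, mul_assoc, hneg] at h2
    exact eq_of_neg_one_pow_mul_add_eq_zero h2

/-- The counit. -/
noncomputable def counit : NSym R →ₐ[R] R := FreeAlgebra.lift R fun _ => 0

theorem counit_complete_succ (n : ℕ) : counit (complete R (n + 1)) = 0 := by
  have h2 := iota_eq_complete R n.succPNat
  rw [Nat.succPNat_coe, Nat.succ_eq_add_one] at h2
  rw [← h2, counit, FreeAlgebra.lift_ι_apply]

theorem counit_elementary_succ (n : ℕ) : counit (elementary R (n + 1)) = 0 := by
  induction n using Nat.strong_induction_on with
  | _ n ih =>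
    rw [elementary, map_sum]
    refine Finset.sum_eq_zero fun i _ => ?_
    have : n + 1 - i.val = (n - i.val) + 1 := by omega
    rw [map_mul, this, counit_complete_succ, mul_zero]

/-- The functional pairing with the row-strict dual immaculate function of a list of parts. -/
noncomputable def dualFunctional : List ℕ → NSym R →ₗ[R] R
  | [] => (counit (R := R)).toLinearMap
  | a :: α => (dualFunctional α).comp
      (((lcoeff (NSym R) (a - 1)).restrictScalars R).comp (firstRow R))

theorem dualFunctional_nil (x : NSym R) : dualFunctional [] x = counit x := rfl

theorem dualFunctional_cons (a : ℕ) (α : List ℕ) (x : NSym R) :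
    dualFunctional (a :: α) x = dualFunctional α ((firstRow R x).coeff (a - 1)) := rfl

/-- The reduction of the Pieri rule: multiplying by E and removing the first part leaves a pairing
with a single D_s. -/
theorem dualFunctional_cons_elementary_mul (a m : ℕ) (α : List ℕ) (x : NSym R) :
    dualFunctional ((a + 1) :: α) (elementary R (m + 1) * x) =
      if m ≤ a then dualFunctional α (skewCoeff (a - m) x) else 0 := by
  rw [dualFunctional_cons, firstRow_elementary_mul, Nat.add_sub_cancel, coeff_X_pow_mul']
  split_ifs <;> simp [skewCoeff_apply]

/-- Under `firstRow` the terms of B_{b+1} x become t^{b+i} D(G_i x), and these sum to t^b x because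
D inverts ∑ t^i G_i. -/
theorem dualFunctional_cons_creation (a b : ℕ) (α : List ℕ) (x : NSym R) :
    dualFunctional ((a + 1) :: α) (creation (b + 1 : ℕ) x) =
      if a = b then dualFunctional α x else 0 := by
  have h : firstRow R (creation (b + 1 : ℕ) x) = X ^ b * C x := by
    rw [creation_eq_sum _ x (Nat.lt_succ_self _), map_sum, ← collect_skew_skewInv x]
    conv_rhs => rw [as_sum_range' (skewInv R x) _ (Nat.lt_succ_self _)]
    rw [map_sum, Finset.mul_sum]
    refine Finset.sum_congr rfl fun i _ => ?_
    have : ((b + 1 : ℕ) : ℤ) + i = (b + i + 1 : ℕ) := by push_cast; ring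
    rw [this, elementaryInt_natCast, firstRow_elementary_mul, ← C_mul_X_pow_eq_monomial, map_mul,
      map_pow, collect_X, collect_C, ← X_pow_mul, pow_add, mul_assoc]
    rfl
  rw [dualFunctional_cons, h, X_pow_mul, coeff_C_mul_X_pow, Nat.add_sub_cancel]
  split_ifs <;> simp

theorem dualFunctional_nil_creation (b : ℕ) (x : NSym R) :
    dualFunctional [] (creation (b + 1 : ℕ) x) = 0 := by
  rw [creation_eq_sum _ x (Nat.lt_succ_self _), map_sum]
  refine Finset.sum_eq_zero fun i _ => ?_
  have : ((b + 1 : ℕ) : ℤ) + i = (b + i + 1 : ℕ) := by push_cast; ring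
  rw [this, elementaryInt_natCast, dualFunctional_nil, map_mul, counit_elementary_succ, zero_mul]

variable (R) in
/-- The row-strict immaculate function of a list of parts. -/
noncomputable def immaculate : List ℕ → NSym R
  | [] => 1
  | b :: β => creation (b : ℤ) (immaculate β)

theorem dualFunctional_immaculate (α β : List ℕ) (hα : ∀ a ∈ α, 0 < a) (hβ : ∀ b ∈ β, 0 < b) :
    dualFunctional α (immaculate R β) = if α = β then 1 else 0 := by
  induction β generalizing α with
  | nil =>
    rcases α with _ | ⟨a, α⟩
    · simp [immaculate, dualFunctional_nil]
    · simp [immaculate, dualFunctional_cons, firstRow_one]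
  | cons b β ih =>
    obtain ⟨b, rfl⟩ : ∃ k, b = k + 1 := ⟨b - 1, by have := hβ b (by simp); omega⟩
    rcases α with _ | ⟨a, α⟩
    · rw [immaculate, dualFunctional_nil_creation, if_neg (by simp)]
    obtain ⟨a, rfl⟩ : ∃ k, a = k + 1 := ⟨a - 1, by have := hα a (by simp); omega⟩
    rw [immaculate, dualFunctional_cons_creation, ih α (fun x hx => hα x (by simp [hx]))
      (fun x hx => hβ x (by simp [hx]))]
    by_cases h : a = b <;> by_cases h' : α = β <;> simp [h, h']

/-! ### The span of the row-strict immaculate functions -/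

variable (R) in
/-- The span of the row-strict immaculate functions of compositions. -/
noncomputable def immaculateSpan : Submodule R (NSym R) :=
  Submodule.span R (immaculate R '' {β | ∀ b ∈ β, 0 < b})

theorem creation_mem_immaculateSpan {b : ℤ} (hb : 0 < b) {x : NSym R}
    (hx : x ∈ immaculateSpan R) : creation b x ∈ immaculateSpan R := by
  rw [immaculateSpan] at hx
  induction hx using Submodule.span_induction with
  | mem x h =>
    obtain ⟨β, hβ, rfl⟩ := h
    refine Submodule.subset_span ⟨b.toNat :: β, ?_, ?_⟩
    · intro c hc
      rcases List.mem_cons.1 hc with rfl | hc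
      · omega
      · exact hβ c hc
    · rw [immaculate, Int.toNat_of_nonneg hb.le]
  | zero => simp
  | add x y _ _ hx hy => rw [map_add]; exact add_mem hx hy
  | smul r x _ hx => rw [map_smul]; exact Submodule.smul_mem _ _ hx

/-- Of the two formulas for D_s B_b, the one chosen on each side of s = b involves only B with
positive subscripts. The leftover E_{b-s} is 1 or 0. -/
theorem skewCoeff_immaculate_mem (β : List ℕ) (hβ : ∀ b ∈ β, 0 < b) (s : ℕ) :
    skewCoeff s (immaculate R β) ∈ immaculateSpan R := by
  induction β generalizing s with
  | nil =>
    rw [immaculate, skewCoeff_one]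
    split_ifs
    · exact Submodule.subset_span ⟨[], by simp, rfl⟩
    · exact zero_mem _
  | cons b β ih =>
    have ih := ih fun x hx => hβ x (by simp [hx])
    rw [immaculate]
    rcases lt_or_ge s b with h | h
    · rw [skewCoeff_creation]
      refine sum_mem fun p hp => creation_mem_immaculateSpan ?_ (ih _)
      have := Finset.mem_range.1 hp
      omega
    · rw [eq_sub_of_add_eq (skewCoeff_creation_add s b (immaculate R β) (Nat.lt_succ_self _))]
      refine sub_mem ?_ (sum_mem fun p _ => creation_mem_immaculateSpan (by omega) (ih _))
      rcases eq_or_lt_of_le h with rfl | h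
      · simpa [skewCoeff_zero] using ih 0
      · rw [elementaryInt_of_neg R (by omega), zero_mul]
        exact zero_mem _

/-- The span contains 1 and, by E_m = ∑ B_{m+q} D_q, is stable under left multiplication by each E_m
with m > 0. -/
theorem immaculateSpan_eq_top : immaculateSpan R = ⊤ := by
  rw [eq_top_iff]
  intro x _
  refine mem_of_mul_mem (adjoin_elementary R) (immaculateSpan R)
    (Submodule.subset_span ⟨[], by simp, rfl⟩) ?_ x
  rintro _ ⟨m, rfl⟩ x hx
  rw [immaculateSpan] at hx
  induction hx using Submodule.span_induction with
  | mem x h =>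
    obtain ⟨β, hβ, rfl⟩ := h
    dsimp only
    rw [← elementaryInt_natCast, ← sum_creation_skewCoeff _ _ (Nat.lt_succ_self _)]
    exact sum_mem fun q _ =>
      creation_mem_immaculateSpan (by omega) (skewCoeff_immaculate_mem β hβ q)
  | zero => simp
  | add x y _ _ hx hy => rw [mul_add]; exact add_mem hx hy
  | smul r x _ hx => rw [mul_smul_comm]; exact Submodule.smul_mem _ _ hx

/-- The functionals separate points. -/
theorem eq_of_dualFunctional_eq {x y : NSym R}
    (h : ∀ α : List ℕ, (∀ a ∈ α, 0 < a) → dualFunctional α x = dualFunctional α y) : x = y := by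
  rw [← sub_eq_zero]
  have hz : ∀ α : List ℕ, (∀ a ∈ α, 0 < a) → dualFunctional α (x - y) = 0 := fun α hα => by
    rw [map_sub, h α hα, sub_self]
  have hmem : x - y ∈ immaculateSpan R := by rw [immaculateSpan_eq_top]; trivial
  rw [immaculateSpan, Finsupp.mem_span_image_iff_linearCombination] at hmem
  obtain ⟨c, hc, hxy⟩ := hmem
  rw [Finsupp.mem_supported] at hc
  have h0 : c = 0 := by
    ext α
    by_cases hα : α ∈ c.support
    · have := hz α (hc hα)
      rw [← hxy, Finsupp.linearCombination_apply, Finsupp.sum, map_sum,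
        Finset.sum_eq_single α] at this
      · simpa [dualFunctional_immaculate α α (hc hα) (hc hα)] using this
      · intro β hβ hne
        rw [map_smul, dualFunctional_immaculate α β (hc hα) (hc hβ), if_neg hne.symm, smul_zero]
      · simp +contextual
    · simpa using hα
  rw [← hxy, h0, map_zero]

/-! ### Pairing with skewed row-strict immaculate functions -/

theorem dualFunctional_nil_skewCoeff_creation (s a : ℕ) (x : NSym R) :
    dualFunctional [] (skewCoeff s (creation (a + 1 : ℕ) x)) =
      if a + 1 = s then dualFunctional [] x else 0 := by
  rcases lt_or_ge s (a + 1) with h | h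
  · rw [skewCoeff_creation, map_sum, if_neg (by omega)]
    refine Finset.sum_eq_zero fun p hp => ?_
    have hp := Finset.mem_range.1 hp
    have : ((a + 1 : ℕ) : ℤ) - p = (a - p + 1 : ℕ) := by omega
    rw [this, dualFunctional_nil_creation]
  · rw [eq_sub_of_add_eq (skewCoeff_creation_add s _ x (Nat.lt_succ_self _)), map_sub, map_sum]
    rw [Finset.sum_eq_zero, sub_zero]
    · split_ifs with h2
      · rw [h2, sub_self, elementaryInt_zero, one_mul]
      · rw [elementaryInt_of_neg R (by omega), zero_mul, map_zero]
    · intro q _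
      have : ((a + 1 : ℕ) : ℤ) + q + 1 = (a + 1 + q + 1 : ℕ) := by omega
      rw [this, dualFunctional_nil_creation]

/-- Only the term of `skewCoeff_creation` with a - p = g survives, and it must have 0 ≤ p ≤ s. -/
theorem dualFunctional_cons_skewCoeff_creation_of_lt (s a g : ℕ) (γ : List ℕ) (x : NSym R)
    (h : s < a) (hg : 0 < g) :
    dualFunctional (g :: γ) (skewCoeff s (creation a x)) =
      if g ≤ a ∧ a ≤ s + g then dualFunctional γ (skewCoeff (s + g - a) x) else 0 := by
  obtain ⟨g, rfl⟩ : ∃ k, g = k + 1 := ⟨g - 1, by omega⟩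
  rw [skewCoeff_creation, map_sum]
  have key : ∀ p ∈ Finset.range (s + 1), dualFunctional ((g + 1) :: γ)
      (creation ((a : ℤ) - p) (skewCoeff (s - p) x)) =
      if p + g + 1 = a then dualFunctional γ (skewCoeff (s - p) x) else 0 := by
    intro p hp
    have hp := Finset.mem_range.1 hp
    have : (a : ℤ) - p = (a - 1 - p + 1 : ℕ) := by omega
    rw [this, dualFunctional_cons_creation]
    congr 1
    apply propext
    omega
  rw [Finset.sum_congr rfl key]
  split_ifs with hc
  · rw [Finset.sum_eq_single (a - (g + 1))]
    · rw [if_pos (by omega)]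
      congr 3
      omega
    · intro p _ hp
      rw [if_neg (by omega)]
    · intro hp
      exact absurd (Finset.mem_range.2 (by omega)) hp
  · refine Finset.sum_eq_zero fun p hp => ?_
    have hp := Finset.mem_range.1 hp
    rw [if_neg (by omega)]

/-- In `skewCoeff_creation_add` only E_{a-s}, nonzero just for a = s, and the term with a + q + 1 =
g contribute. -/
theorem dualFunctional_cons_skewCoeff_creation_of_le (s a g : ℕ) (γ : List ℕ) (x : NSym R)
    (h : a ≤ s) (hg : 0 < g) :
    dualFunctional (g :: γ) (skewCoeff s (creation a x)) =
      (if a = s then dualFunctional (g :: γ) x else 0) -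
        if a < g then dualFunctional γ (skewCoeff (s + g - a) x) else 0 := by
  obtain ⟨g, rfl⟩ : ∃ k, g = k + 1 := ⟨g - 1, by omega⟩
  -- The summand `g` makes the range long enough to contain the index q = g - a, whatever the
  -- degree.
  have hN : (skew R x).natDegree < (skew R x).natDegree + g + 1 := by omega
  rw [eq_sub_of_add_eq (skewCoeff_creation_add s a x hN), map_sub, map_sum]
  congr 1
  · split_ifs with h2
    · rw [h2, sub_self, elementaryInt_zero, one_mul]
    · rw [elementaryInt_of_neg R (by omega), zero_mul, map_zero]
  have key : ∀ q ∈ Finset.range ((skew R x).natDegree + g + 1), dualFunctional ((g + 1) :: γ)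
      (creation ((a : ℤ) + q + 1) (skewCoeff (s + q + 1) x)) =
      if g = a + q then dualFunctional γ (skewCoeff (s + q + 1) x) else 0 := by
    intro q _
    have : (a : ℤ) + q + 1 = (a + q + 1 : ℕ) := by omega
    rw [this, dualFunctional_cons_creation]
  rw [Finset.sum_congr rfl key]
  split_ifs with hc
  · rw [Finset.sum_eq_single (g - a)]
    · rw [if_pos (by omega)]
      congr 3
      omega
    · intro p _ hp
      rw [if_neg (by omega)]
    · intro hp
      exact absurd (Finset.mem_range.2 (by omega)) hp
  · refine Finset.sum_eq_zero fun p hp => ?_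
    rw [if_neg (by omega)]

end Duality

/-! ### The coefficients c^γ_{s,α} obey the recursion of the pairings. -/

section PieriCoefficients

theorem sum_Iio_succ {n : ℕ} (v : Fin (n + 1) → ℤ) (i : Fin n) :
    ∑ t ∈ Finset.Iio i.succ, v t = v 0 + ∑ t ∈ Finset.Iio i, v t.succ := by
  have h : ∀ {m : ℕ} (j : Fin m) (w : Fin m → ℤ),
      ∑ t ∈ Finset.Iio j, w t = ∑ t, if t < j then w t else 0 := by
    intro m j w
    rw [← Finset.sum_filter]
    congr 1
    ext
    simp
  rw [h, h, Fin.sum_univ_succ]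
  simp

theorem sum_Iic_succ {n : ℕ} (v : Fin (n + 1) → ℤ) (i : Fin n) :
    ∑ t ∈ Finset.Iic i.succ, v t = v 0 + ∑ t ∈ Finset.Iic i, v t.succ := by
  have h : ∀ {m : ℕ} (j : Fin m) (w : Fin m → ℤ),
      ∑ t ∈ Finset.Iic j, w t = ∑ t, if t ≤ j then w t else 0 := by
    intro m j w
    rw [← Finset.sum_filter]
    congr 1
    ext
    simp
  rw [h, h, Fin.sum_univ_succ]
  simp

theorem inZ_nil (s : ℤ) (v : Fin ([] : List ℕ).length → ℤ) : InZ s [] v ↔ s = 0 := by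
  have : IsEmpty (Fin ([] : List ℕ).length) := inferInstanceAs (IsEmpty (Fin 0))
  simp [InZ, eq_comm]

/-- Each condition splits into one on the first entry and the same one for the tail with s - v_1 in
place of s. Only the bound on zeros of α - v and the clause v_{i+1} = ⋯ = 0 couple the two. -/
theorem inZ_cons {s : ℤ} {a : ℕ} {α : List ℕ} (v : Fin (α.length + 1) → ℤ) :
    InZ s (a :: α) v ↔
      (α ≠ [] → v 0 ≤ s) ∧ v 0 ≤ a ∧ (v 0 = a → ∀ i : Fin α.length, (α.get i : ℤ) ≠ v i.succ) ∧
      (s < a → 0 ≤ v 0 ∧ v 0 ≤ s) ∧ (a < s → v 0 < 0) ∧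
      (a = s → v 0 < 0 ∨ v 0 = a ∧ ∀ t : Fin α.length, v t.succ = 0) ∧
      InZ (s - v 0) α (fun i => v i.succ) := by
  unfold InZ
  have hcard : (Finset.univ.filter fun i : Fin (a :: α).length =>
      ((a :: α).get i : ℤ) - v i = 0).card ≤ 1 ↔
      (v 0 = a → ∀ i : Fin α.length, (α.get i : ℤ) ≠ v i.succ) ∧
      (Finset.univ.filter fun i : Fin α.length => (α.get i : ℤ) - v i.succ = 0).card ≤ 1 := by
    have h1 := Fin.card_filter_univ_succ (n := α.length)
      (fun i : Fin (α.length + 1) => ((a :: α).get i : ℤ) - v i = 0)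
    have h2 : (Finset.univ.filter fun i : Fin α.length => (α.get i : ℤ) - v i.succ = 0).card = 0 ↔
        ∀ i : Fin α.length, (α.get i : ℤ) ≠ v i.succ := by
      simp [Finset.filter_eq_empty_iff, sub_eq_zero]
    change (Finset.univ.filter fun i : Fin (α.length + 1) =>
      ((a :: α).get i : ℤ) - v i = 0).card ≤ 1 ↔ _
    rw [h1, ← h2]
    have h3 : ((a :: α).get 0 : ℤ) - v 0 = 0 ↔ v 0 = a := by
      rw [sub_eq_zero, eq_comm]; rfl
    simp only [h3]
    change (if v 0 = a then
      (Finset.univ.filter fun i : Fin α.length => (α.get i : ℤ) - v i.succ = 0).card + 1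
      else (Finset.univ.filter fun i : Fin α.length => (α.get i : ℤ) - v i.succ = 0).card) ≤ 1 ↔ _
    generalize (Finset.univ.filter fun i : Fin α.length => (α.get i : ℤ) - v i.succ = 0).card = c
    split_ifs with h <;> simp only [h, forall_true_left, false_imp_iff, true_and]
    omega
  rw [hcard]
  have hsum : ∑ i : Fin (a :: α).length, v i = s ↔ ∑ i : Fin α.length, v i.succ = s - v 0 := by
    have := Fin.sum_univ_succ v
    change ∑ i : Fin (α.length + 1), v i = s ↔ _
    omega
  have hpart : (∀ i : Fin (a :: α).length, i.val + 1 < (a :: α).length →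
      ∑ t ∈ Finset.Iic i, v t ≤ s) ↔ (α ≠ [] → v 0 ≤ s) ∧
      ∀ i : Fin α.length, i.val + 1 < α.length → ∑ t ∈ Finset.Iic i, v t.succ ≤ s - v 0 := by
    change (∀ i : Fin (α.length + 1), i.val + 1 < α.length + 1 → ∑ t ∈ Finset.Iic i, v t ≤ s) ↔ _
    rw [Fin.forall_fin_succ]
    refine and_congr ?_ (forall_congr' fun i => ?_)
    · have : (Finset.Iic (0 : Fin (α.length + 1))) = {0} := by ext; simp
      rw [this, Finset.sum_singleton]
      simp [List.length_pos_iff]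
    · rw [sum_Iic_succ, Fin.val_succ, add_lt_add_iff_right, le_sub_iff_add_le']
  have hnonneg : (∀ i : Fin (a :: α).length, 0 ≤ ((a :: α).get i : ℤ) - v i) ↔
      v 0 ≤ a ∧ ∀ i : Fin α.length, 0 ≤ (α.get i : ℤ) - v i.succ := by
    change (∀ i : Fin (α.length + 1), 0 ≤ ((a :: α).get i : ℤ) - v i) ↔ _
    rw [Fin.forall_fin_succ]
    refine and_congr ?_ Iff.rfl
    rw [sub_nonneg]
    rfl
  rw [hsum, hpart, hnonneg]
  have htri : (∀ i : Fin (a :: α).length,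
      (((a :: α).get i : ℤ) > s - ∑ t ∈ Finset.Iio i, v t →
        0 ≤ v i ∧ v i ≤ s - ∑ t ∈ Finset.Iio i, v t) ∧
      (((a :: α).get i : ℤ) < s - ∑ t ∈ Finset.Iio i, v t → v i < 0) ∧
      (((a :: α).get i : ℤ) = s - ∑ t ∈ Finset.Iio i, v t →
        v i < 0 ∨ (v i = ((a :: α).get i : ℤ) ∧ ∀ t, i < t → v t = 0))) ↔
      ((s < a → 0 ≤ v 0 ∧ v 0 ≤ s) ∧ (a < s → v 0 < 0) ∧
      (a = s → v 0 < 0 ∨ v 0 = a ∧ ∀ t : Fin α.length, v t.succ = 0)) ∧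
      ∀ i : Fin α.length,
      ((α.get i : ℤ) > s - v 0 - ∑ t ∈ Finset.Iio i, v t.succ →
        0 ≤ v i.succ ∧ v i.succ ≤ s - v 0 - ∑ t ∈ Finset.Iio i, v t.succ) ∧
      ((α.get i : ℤ) < s - v 0 - ∑ t ∈ Finset.Iio i, v t.succ → v i.succ < 0) ∧
      ((α.get i : ℤ) = s - v 0 - ∑ t ∈ Finset.Iio i, v t.succ →
        v i.succ < 0 ∨ (v i.succ = (α.get i : ℤ) ∧ ∀ t, i < t → v t.succ = 0)) := by
    change (∀ i : Fin (α.length + 1), (((a :: α).get i : ℤ) > s - ∑ t ∈ Finset.Iio i, v t →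
        0 ≤ v i ∧ v i ≤ s - ∑ t ∈ Finset.Iio i, v t) ∧
      (((a :: α).get i : ℤ) < s - ∑ t ∈ Finset.Iio i, v t → v i < 0) ∧
      (((a :: α).get i : ℤ) = s - ∑ t ∈ Finset.Iio i, v t →
        v i < 0 ∨ (v i = ((a :: α).get i : ℤ) ∧ ∀ t : Fin (α.length + 1), i < t → v t = 0))) ↔ _
    rw [Fin.forall_fin_succ]
    refine and_congr ?_ (forall_congr' fun i => ?_)
    · have : (Finset.Iio (0 : Fin (α.length + 1))) = ∅ := by ext; simp
      rw [this, Finset.sum_empty, sub_zero]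
      have h0 : (a :: α).get 0 = a := rfl
      have h1 : (∀ t : Fin (α.length + 1), 0 < t → v t = 0) ↔
          ∀ t : Fin α.length, v t.succ = 0 := by
        rw [Fin.forall_fin_succ]; simp
      rw [h1]
      rfl
    · have h1 : (∀ t : Fin (α.length + 1), i.succ < t → v t = 0) ↔
          ∀ t : Fin α.length, i < t → v t.succ = 0 := by
        rw [Fin.forall_fin_succ]; simp
      rw [sum_Iio_succ, h1, sub_add_eq_sub_sub]
      rfl
  rw [htri]
  constructor
  · rintro ⟨⟨hs, hp, hp'⟩, ⟨⟨hn, hn'⟩, hz, hz'⟩, ⟨h1, h2, h3⟩, ht⟩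
    exact ⟨hp, hn, hz, h1, h2, h3, ⟨hs, hp'⟩, ⟨hn', hz'⟩, ht⟩
  · rintro ⟨hp, hn, hz, h1, h2, h3, ⟨hs, hp'⟩, ⟨hn', hz'⟩, ht⟩
    exact ⟨⟨hs, hp, hp'⟩, ⟨⟨hn, hn'⟩, hz, hz'⟩, ⟨h1, h2, h3⟩, ht⟩

theorem sgn_succ {k : ℕ} (v : Fin (k + 1) → ℤ) :
    sgn v = (if v 0 < 0 then -1 else 1) * sgn (fun i => v i.succ) := by
  unfold sgn
  rw [Fin.card_filter_univ_succ]
  change (-1 : ℤ) ^ (if v 0 < 0 then (Finset.univ.filter fun i : Fin k => v i.succ < 0).card + 1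
    else (Finset.univ.filter fun i : Fin k => v i.succ < 0).card) = _
  split_ifs
  · rw [pow_succ, mul_comm]
  · rw [one_mul]

theorem inZ_zero {α : List ℕ} (hα : ∀ a ∈ α, 0 < a) (s : ℤ) :
    InZ s α (fun _ => 0) ↔ s = 0 := by
  induction α with
  | nil => exact inZ_nil s _
  | cons a α ih =>
    have ha : 0 < a := hα a (by simp)
    have h := inZ_cons (s := s) (a := a) (α := α) (fun _ => 0)
    refine h.trans ?_
    rw [sub_zero, ih fun x hx => hα x (by simp [hx])]
    constructor
    · tauto
    · rintro rfl
      refine ⟨by simp, by simp, fun h => by omega, by simp, fun h => by omega, fun h => by omega,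
        rfl⟩

theorem inZ_cons_zero {a : ℕ} {α : List ℕ} (hα : ∀ x ∈ a :: α, 0 < x) {s : ℤ}
    (v : Fin (α.length + 1) → ℤ) (h0 : v 0 = a) (hv : ∀ i : Fin α.length, v i.succ = 0) :
    InZ s (a :: α) v ↔ s = a := by
  have ha : 0 < a := hα a (by simp)
  rw [inZ_cons, h0]
  simp only [hv]
  rw [inZ_zero fun x hx => hα x (by simp [hx])]
  constructor
  · intro h; omega
  · rintro rfl
    refine ⟨fun _ => le_rfl, le_rfl, fun _ i => ?_, by simp, by simp, by simp, by simp⟩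
    have := hα (α.get i) (by simp)
    omega

/-- As g > 0, v_1 = a - g differs from a, so both coupling clauses disappear. The bound v_1 ≤ s is
then automatic, by s ≥ 0. -/
theorem inZ_cons_of_pos {s : ℤ} (hs : 0 ≤ s) {a g : ℕ} (hg : 0 < g) {α : List ℕ}
    (v : Fin (α.length + 1) → ℤ) (h0 : v 0 = (a : ℤ) - g) :
    InZ s (a :: α) v ↔ ((s < a → g ≤ a ∧ a ≤ s + g) ∧ (a ≤ s → a < g)) ∧
      InZ (s + g - a) α (fun i => v i.succ) := by
  rw [inZ_cons, h0]
  have : s - ((a : ℤ) - g) = s + g - a := by ring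
  rw [this]
  constructor
  · rintro ⟨-, -, -, h1, h2, h3, h4⟩
    refine ⟨⟨fun h => ?_, fun h => ?_⟩, h4⟩ <;> omega
  · rintro ⟨⟨h1, h2⟩, h4⟩
    refine ⟨fun _ => ?_, ?_, fun h => ?_, fun h => ?_, fun h => ?_, fun h => ?_, h4⟩
    · rcases lt_or_ge s a with h | h
      · have := h1 h; omega
      · have := h2 h; omega
    · omega
    · omega
    · have := h1 h; omega
    · have := h2 h.le; omega
    · have := h2 h.le; left; omega

theorem pieriJ_tail (a : ℕ) (α : List ℕ) : pieriJ (a :: α) α = 0 := by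
  rw [pieriJ, Nat.find_eq_zero]
  intro i hi h
  obtain ⟨i, rfl⟩ : ∃ k, i = k + 1 := ⟨i - 1, by omega⟩
  simp

/-- Index 0 fails exactly because α ≠ g :: γ, so the minimum is attained one place further along. -/
theorem pieriJ_cons_cons {a g : ℕ} {α γ : List ℕ} (hl : γ.length + 1 = α.length)
    (hne : α ≠ g :: γ) : pieriJ (a :: α) (g :: γ) = pieriJ α γ + 1 := by
  unfold pieriJ
  rw [Nat.find_comp_succ _ ⟨α.length + 1, fun i hi h => absurd hi (by simp; omega)⟩]
  · congr 1
    refine Nat.find_congr' fun {j} => ?_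
    constructor
    · intro h i hi hj
      have := h (i + 1) (by simpa using hi) (by omega)
      obtain ⟨i, rfl⟩ : ∃ k, i = k + 1 := ⟨i - 1, by omega⟩
      simpa using this
    · intro h i hi hj
      obtain ⟨i, rfl⟩ : ∃ k, i = k + 2 := ⟨i - 2, by omega⟩
      have := h (i + 1) (by simp only [List.length_cons] at hi; omega) (by omega)
      simpa using this
  · intro h
    refine hne (List.ext_getElem (by simpa using hl.symm) fun i h1 h2 => ?_)
    have := h (i + 1) (by simpa using h1) (by omega)
    rw [List.getD_cons_succ, Nat.add_sub_cancel, List.getD_eq_getElem _ _ h1,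
      List.getD_eq_getElem _ _ h2] at this
    exact this

theorem pieriJ_le {α γ : List ℕ} : pieriJ α γ ≤ α.length - 1 :=
  Nat.find_min' _ fun i hi h => absurd hi (by omega)

theorem pieriR_cons_cons {a g : ℕ} {α γ : List ℕ} (hl : γ.length + 1 = α.length)
    (hne : α ≠ g :: γ) : pieriR (a :: α) (g :: γ) = pieriR α γ + 1 := by
  have hspec := Nat.findGreatest_spec (n := α.length - 1) (P := fun r => pieriJ α γ ≤ r ∧
    ∀ i < r, pieriJ α γ ≤ i → α.getD i 0 < α.getD (i + 1) 0) pieriJ_le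
    ⟨le_rfl, fun i hi h => absurd hi (by omega)⟩
  have hle : pieriR α γ ≤ α.length - 1 := Nat.findGreatest_le _
  have hmax : ∀ r, pieriR α γ < r → r ≤ α.length - 1 → ¬ (pieriJ α γ ≤ r ∧
    ∀ i < r, pieriJ α γ ≤ i → α.getD i 0 < α.getD (i + 1) 0) :=
    fun r h1 h2 => Nat.findGreatest_is_greatest h1 h2
  change pieriJ α γ ≤ pieriR α γ ∧ ∀ i < pieriR α γ, _ at hspec
  conv_lhs => rw [pieriR]
  rw [pieriJ_cons_cons hl hne, Nat.findGreatest_eq_iff]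
  refine ⟨by simp; omega, fun _ => ⟨by omega, fun i hi h => ?_⟩, fun r h1 h2 h3 => ?_⟩
  · obtain ⟨i, rfl⟩ : ∃ k, i = k + 1 := ⟨i - 1, by omega⟩
    simpa using hspec.2 i (by omega) (by omega)
  · obtain ⟨r, rfl⟩ : ∃ k, r = k + 1 := ⟨r - 1, by omega⟩
    simp only [List.length_cons] at h2
    refine hmax r (by omega) (by omega) ⟨by omega, fun i hi h => ?_⟩
    simpa using h3.2 (i + 1) (by omega) (by omega)

/-- Here j = 0 for both pairs: the increasing run from a either stops at once or prolongs the run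
from g by one, which flips the parity of r. -/
theorem pieriR_tail_cons (a g : ℕ) (γ : List ℕ) :
    pieriR (a :: g :: γ) (g :: γ) = if a < g then pieriR (g :: γ) γ + 1 else 0 := by
  have hspec := Nat.findGreatest_spec (n := (g :: γ).length - 1)
    (P := fun r => pieriJ (g :: γ) γ ≤ r ∧
    ∀ i < r, pieriJ (g :: γ) γ ≤ i → (g :: γ).getD i 0 < (g :: γ).getD (i + 1) 0) (Nat.zero_le _)
    ⟨by simp [pieriJ_tail], fun i hi h => absurd hi (by omega)⟩
  have hle : pieriR (g :: γ) γ ≤ (g :: γ).length - 1 := Nat.findGreatest_le _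
  have hmax : ∀ r, pieriR (g :: γ) γ < r → r ≤ (g :: γ).length - 1 → ¬ (pieriJ (g :: γ) γ ≤ r ∧
    ∀ i < r, pieriJ (g :: γ) γ ≤ i → (g :: γ).getD i 0 < (g :: γ).getD (i + 1) 0) :=
    fun r h1 h2 => Nat.findGreatest_is_greatest h1 h2
  change pieriJ (g :: γ) γ ≤ pieriR (g :: γ) γ ∧ ∀ i < pieriR (g :: γ) γ, _ at hspec
  simp only [pieriJ_tail, List.length_cons, Nat.add_sub_cancel] at hspec hle hmax
  conv_lhs => rw [pieriR]
  rw [pieriJ_tail, Nat.findGreatest_eq_iff]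
  split_ifs with hag
  · refine ⟨by simp; omega, fun _ => ⟨by omega, fun i hi h => ?_⟩, fun r h1 h2 h3 => ?_⟩
    · rcases i with _ | i
      · simpa using hag
      · simpa using hspec.2 i (by omega) (by omega)
    · obtain ⟨r, rfl⟩ : ∃ k, r = k + 1 := ⟨r - 1, by omega⟩
      simp only [List.length_cons] at h2
      refine hmax r (by omega) (by omega) ⟨by omega, fun i hi h => ?_⟩
      simpa using h3.2 (i + 1) (by omega) (by omega)
  · refine ⟨Nat.zero_le _, fun h => absurd rfl h, fun r h1 h2 h3 => hag ?_⟩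
    simpa using h3.2 0 h1 le_rfl

theorem pieriCoeff_nil (s : ℤ) (γ : List ℕ) :
    pieriCoeff s [] γ = if s = 0 ∧ γ = [] then 1 else 0 := by
  unfold pieriCoeff
  rcases γ with _ | ⟨g, γ⟩
  · rw [if_pos rfl, if_congr (inZ_nil s _) rfl rfl]
    simp [sgn]
  · simp

theorem pieriCoeff_tail {a : ℕ} {α : List ℕ} (hα : ∀ x ∈ a :: α, 0 < x) (s : ℤ) :
    pieriCoeff s (a :: α) α = if Even (pieriR (a :: α) α) ∧ s = a then 1 else 0 := by
  unfold pieriCoeff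
  have h := inZ_cons_zero (s := s) hα
    (v := fun i => if i.val < pieriJ (a :: α) α then ((a :: α).get i : ℤ) - α.getD i 0
      else if i.val = pieriJ (a :: α) α then ((a :: α).get i : ℤ) else 0)
    (by simp [pieriJ_tail]) (by simp [pieriJ_tail])
  rw [if_neg (by simp), if_pos (by simp)]
  have hs : sgn (fun i : Fin (pieriJ (a :: α) α) => ((a :: α).getD i 0 : ℤ) - α.getD i 0) = 1 := by
    have : IsEmpty (Fin (pieriJ (a :: α) α)) := by rw [pieriJ_tail]; infer_instance
    simp [sgn]
  rw [hs]
  refine if_congr (and_congr ?_ h) rfl rfl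
  rw [pieriJ_tail, Nat.sub_zero]

theorem pieriCoeff_cons_nil {a : ℕ} {α : List ℕ} (hα : ∀ x ∈ a :: α, 0 < x) (s : ℤ) :
    pieriCoeff s (a :: α) [] = if α = [] ∧ s = a then 1 else 0 := by
  rcases α with _ | ⟨b, α⟩
  · rw [pieriCoeff_tail hα]
    simp [pieriR]
  · simp [pieriCoeff]

theorem sgn_congr_length {k l : ℕ} (h : k = l) (f : ℕ → ℤ) :
    sgn (fun i : Fin k => f i) = sgn (fun i : Fin l => f i) := by
  subst h; rfl

theorem pieriCoeff_cons_cons_of_ne {s : ℤ} (hs : 0 ≤ s) {a g : ℕ} (hg : 0 < g) {α γ : List ℕ}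
    (hne : α ≠ g :: γ) :
    pieriCoeff s (a :: α) (g :: γ) =
      (if (s < a → g ≤ a ∧ a ≤ s + g) ∧ (a ≤ s → a < g) then
        (if a < g then -1 else 1) * pieriCoeff (s + g - a) α γ else 0) := by
  have hneg : ((a : ℤ) - g < 0) = (a < g) := by apply propext; omega
  unfold pieriCoeff
  simp only [List.length_cons, add_left_inj]
  by_cases hl : γ.length = α.length
  · rw [if_pos hl, if_pos hl]
    have h := inZ_cons_of_pos hs (a := a) (α := α) hg
      (fun i => ((a :: α).get i : ℤ) - (g :: γ).getD i 0) (by simp)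
    have h2 := sgn_succ (k := α.length)
      (fun i => ((a :: α).get i : ℤ) - (g :: γ).getD i 0)
    rw [if_congr h rfl rfl]
    erw [h2]
    simp [hneg, ite_and]
  · rw [if_neg hl, if_neg hl]
    by_cases hl' : γ.length + 1 = α.length
    · rw [if_pos hl', if_pos hl']
      have h := inZ_cons_of_pos hs (a := a) (α := α) hg
        (fun i => if i.val < pieriJ (a :: α) (g :: γ) then
          ((a :: α).get i : ℤ) - (g :: γ).getD i 0
          else if i.val = pieriJ (a :: α) (g :: γ) then ((a :: α).get i : ℤ) else 0)
        (by simp [pieriJ_cons_cons hl' hne])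
      have h2 := sgn_congr_length (pieriJ_cons_cons (a := a) hl' hne)
        (fun i => ((a :: α).getD i 0 : ℤ) - (g :: γ).getD i 0)
      rw [sgn_succ] at h2
      rw [if_congr (and_congr Iff.rfl h) rfl rfl, h2]
      simp only [pieriJ_cons_cons hl' hne, pieriR_cons_cons hl' hne, Nat.add_sub_add_right]
      simp [hneg, ite_and]
      split_ifs <;> simp_all
    · rw [if_neg hl', if_neg hl', mul_zero, ite_self]

theorem pieriCoeff_cons_cons_of_lt {s : ℤ} (hs : 0 ≤ s) {a g : ℕ} (hg : 0 < g) {α γ : List ℕ}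
    (hα : ∀ x ∈ a :: α, 0 < x) (h : s < a) :
    pieriCoeff s (a :: α) (g :: γ) =
      if g ≤ a ∧ a ≤ s + g then pieriCoeff (s + g - a) α γ else 0 := by
  by_cases hne : α = g :: γ
  · subst hne
    rw [pieriCoeff_tail hα, pieriCoeff_tail fun x hx => hα x (by simp [hx])]
    rw [if_neg (by omega)]
    split_ifs <;> first | rfl | omega
  · rw [pieriCoeff_cons_cons_of_ne hs hg hne]
    by_cases hc : g ≤ a ∧ (a : ℤ) ≤ s + g
    · rw [if_pos hc, if_pos ⟨fun _ => hc, fun h' => by omega⟩, if_neg (by omega), one_mul]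
    · rw [if_neg hc, if_neg fun h' => hc (h'.1 h)]

/-- If α = g :: γ and a = s, both terms on the right can be nonzero, and the claim is [r even] = 1 -
[a < g][r' even] with r, r' as in `pieriR_tail_cons`. Otherwise at most the second term is present.
-/
theorem pieriCoeff_cons_cons_of_le {s : ℤ} (hs : 0 ≤ s) {a g : ℕ} (hg : 0 < g) {α γ : List ℕ}
    (hα : ∀ x ∈ a :: α, 0 < x) (h : a ≤ s) :
    pieriCoeff s (a :: α) (g :: γ) =
      (if a = s ∧ g :: γ = α then 1 else 0) -
        if a < g then pieriCoeff (s + g - a) α γ else 0 := by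
  by_cases hne : α = g :: γ
  · subst hne
    rw [pieriCoeff_tail hα, pieriCoeff_tail fun x hx => hα x (by simp [hx]), pieriR_tail_cons]
    have h1 : s + g - a = g ↔ (a : ℤ) = s := by omega
    have h2 : s = a ↔ (a : ℤ) = s := eq_comm
    simp only [h1, h2, and_true]
    by_cases h3 : (a : ℤ) = s <;> by_cases h4 : a < g <;>
      simp [h3, h4, Nat.even_add_one]
    by_cases h5 : Even (pieriR (g :: γ) γ) <;> simp [h5]
  · rw [pieriCoeff_cons_cons_of_ne hs hg hne, if_neg (c := (a : ℤ) = s ∧ _) fun h => hne h.2.symm]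
    by_cases hc : a < g
    · rw [if_pos ⟨fun _ => by omega, fun _ => hc⟩, if_pos hc, if_pos hc]; ring
    · rw [if_neg fun h' => hc (h'.2 h), if_neg hc, sub_zero]

theorem pieriCoeff_length {s : ℤ} {α γ : List ℕ} (h : pieriCoeff s α γ ≠ 0) :
    γ.length = α.length ∨ γ.length + 1 = α.length := by
  by_contra! hc
  exact h (by rw [pieriCoeff, if_neg hc.1, if_neg hc.2])

/-- With `pieriCoeff_length`, shows that restricting the sum to compositions of |α| + m of the
allowed lengths drops no nonzero coefficient. -/
theorem pieriCoeff_sum {α γ : List ℕ} (hα : ∀ x ∈ α, 0 < x) (hγ : ∀ x ∈ γ, 0 < x) {s : ℤ}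
    (hs : 0 ≤ s) (h : pieriCoeff s α γ ≠ 0) : s + γ.sum = α.sum := by
  induction α generalizing s γ with
  | nil =>
    rw [pieriCoeff_nil] at h
    obtain ⟨rfl, rfl⟩ := of_not_not fun hc => h (if_neg hc)
    simp
  | cons a α ih =>
    rcases γ with _ | ⟨g, γ⟩
    · rw [pieriCoeff_cons_nil hα] at h
      obtain ⟨rfl, rfl⟩ := of_not_not fun hc => h (if_neg hc)
      simp
    have hg : 0 < g := hγ g (by simp)
    have ih := @ih γ (fun x hx => hα x (by simp [hx])) (fun x hx => hγ x (by simp [hx]))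
    simp only [List.sum_cons, Nat.cast_add]
    rcases lt_or_ge s a with hsa | hsa
    · rw [pieriCoeff_cons_cons_of_lt hs hg hα hsa] at h
      split_ifs at h with hc
      · have := ih (by omega) h; omega
      · exact absurd rfl h
    · rw [pieriCoeff_cons_cons_of_le hs hg hα hsa] at h
      by_cases h1 : (a : ℤ) = s ∧ g :: γ = α
      · rw [← h1.2, ← h1.1]
        simp
      · rw [if_neg h1, zero_sub, neg_ne_zero] at h
        split_ifs at h with hc
        · have := ih (by omega) h; omega
        · exact absurd rfl h

variable {R : Type*} [CommRing R]

/-- The Pieri rule, in dual form. -/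
theorem dualFunctional_skewCoeff_immaculate {α γ : List ℕ} (hα : ∀ x ∈ α, 0 < x)
    (hγ : ∀ x ∈ γ, 0 < x) (s : ℕ) :
    dualFunctional γ (skewCoeff s (immaculate R α)) = (pieriCoeff s α γ : R) := by
  induction α generalizing s γ with
  | nil =>
    rw [pieriCoeff_nil, immaculate, skewCoeff_one]
    have h := dualFunctional_immaculate (R := R) γ [] hγ (by simp)
    rw [immaculate] at h
    by_cases hs : s = 0
    · rw [if_pos hs, h]
      simp [hs]
    · simp [hs]
  | cons a α ih =>
    have hα' : ∀ x ∈ α, 0 < x := fun x hx => hα x (by simp [hx])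
    rw [immaculate]
    rcases γ with _ | ⟨g, γ⟩
    · obtain ⟨a, rfl⟩ : ∃ k, a = k + 1 := ⟨a - 1, by have := hα a (by simp); omega⟩
      rw [dualFunctional_nil_skewCoeff_creation, pieriCoeff_cons_nil hα,
        dualFunctional_immaculate _ _ (by simp) hα']
      have : (s : ℤ) = (a + 1 : ℕ) ↔ a + 1 = s := by omega
      simp only [this]
      by_cases h1 : a + 1 = s <;> rcases α with _ | ⟨b, α⟩ <;> simp [h1]
    have hg : 0 < g := hγ g (by simp)
    have hγ' : ∀ x ∈ γ, 0 < x := fun x hx => hγ x (by simp [hx])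
    -- In either range the pairing and the coefficient satisfy the same recursion.
    rcases lt_or_ge s a with hsa | hsa
    · rw [dualFunctional_cons_skewCoeff_creation_of_lt _ _ _ _ _ hsa hg, ih hα' hγ',
        pieriCoeff_cons_cons_of_lt (by omega) hg hα (by omega)]
      by_cases hc : g ≤ a ∧ a ≤ s + g
      · rw [if_pos hc, if_pos (by omega), Nat.cast_sub hc.2, Nat.cast_add]
      · rw [if_neg hc, if_neg (by omega), Int.cast_zero]
    · rw [dualFunctional_cons_skewCoeff_creation_of_le _ _ _ _ _ hsa hg, ih hα' hγ',
        dualFunctional_immaculate _ _ hγ hα',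
        pieriCoeff_cons_cons_of_le (by omega) hg hα (by omega), Nat.cast_sub (by omega),
        Nat.cast_add]
      simp only [Nat.cast_inj]
      by_cases h1 : a = s <;> by_cases h2 : g :: γ = α <;> by_cases h3 : a < g <;>
        simp [h1, h2, h3]

end PieriCoefficients

/-! ### Counting row-strict tableaux by removing the bottom row. -/

section Fillings

open Polynomial

/-- `A r` is the set of entries of row `r` of a row-strict immaculate tableau with row lengths `a`
in which the letter `x` appears `c x` times. -/
def IsFilling {k : ℕ} (a : Fin k → ℕ) (c : ℕ → ℕ) (A : Fin k → Finset ℕ) : Prop :=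
  (∀ r, (A r).card = a r) ∧ (∀ r r', r < r' → ∀ x ∈ A r', ∃ y ∈ A r, y ≤ x) ∧
    ∀ x, (Finset.univ.filter fun r => x ∈ A r).card = c x

theorem IsFilling.lt {k l : ℕ} {a : Fin k → ℕ} {c : ℕ → ℕ} {A : Fin k → Finset ℕ}
    (hA : IsFilling a c A) (hc : ∀ x, l ≤ x → c x = 0) {r : Fin k} {x : ℕ} (hx : x ∈ A r) :
    x < l := by
  by_contra! h
  have := hA.2.2 x
  rw [hc x h, Finset.card_eq_zero, Finset.filter_eq_empty_iff] at this
  exact this (Finset.mem_univ r) hx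

theorem finite_filling {k l : ℕ} (a : Fin k → ℕ) (c : ℕ → ℕ) (hc : ∀ x, l ≤ x → c x = 0) :
    Finite {A // IsFilling a c A} := by
  refine Finite.of_injective (β := Fin k → (Finset.range l).powerset)
    (fun A r => ⟨A.1 r, Finset.mem_powerset.2 fun x hx => Finset.mem_range.2 (A.2.lt hc hx)⟩) ?_
  intro A B h
  refine Subtype.ext (funext fun r => ?_)
  exact congrArg Subtype.val (congrFun h r)

theorem getD_eq_zero_of_le (d : List ℕ) (x : ℕ) (hx : d.length ≤ x) : d.getD x 0 = 0 :=
  List.getD_eq_default _ _ hx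

theorem card_filter_mem_cons {k : ℕ} (S : Finset ℕ) (A : Fin k → Finset ℕ) (x : ℕ) :
    (Finset.univ.filter fun r => x ∈ (Fin.cons S A : Fin (k + 1) → Finset ℕ) r).card =
      (if x ∈ S then 1 else 0) + (Finset.univ.filter fun r => x ∈ A r).card := by
  rw [Fin.card_filter_univ_succ]
  simp only [Fin.cons_zero, Fin.cons_succ]
  split_ifs <;> omega

theorem isFilling_cons {k : ℕ} {a : Fin (k + 1) → ℕ} {c c' : ℕ → ℕ} {S : Finset ℕ}
    {A : Fin k → Finset ℕ} (hc : ∀ x, c x = (if x ∈ S then 1 else 0) + c' x) :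
    IsFilling a c (Fin.cons S A : Fin (k + 1) → Finset ℕ) ↔
      S.card = a 0 ∧ (∀ r, ∀ x ∈ A r, ∃ y ∈ S, y ≤ x) ∧
        IsFilling (fun r => a r.succ) c' A := by
  unfold IsFilling
  simp only [card_filter_mem_cons, hc, Fin.forall_fin_succ, Fin.cons_zero, Fin.cons_succ,
    Nat.add_left_cancel_iff, Fin.succ_pos, Fin.not_lt_zero, Fin.succ_lt_succ_iff,
    false_imp_iff, forall_true_left, true_and]
  tauto

/-- The letter 0 does not occur, so all letters can be lowered by one; this mirrors H_0 = 1. -/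
theorem card_filling_zero_cons {k : ℕ} (a : Fin k → ℕ) (d : List ℕ) :
    Nat.card {A // IsFilling a (fun x => (0 :: d).getD x 0) A} =
      Nat.card {A // IsFilling a (fun x => d.getD x 0) A} := by
  symm
  let φ : (Fin k → Finset ℕ) → Fin k → Finset ℕ := fun A r =>
    (A r).map ⟨Nat.succ, Nat.succ_injective⟩
  have hmem : ∀ A r x, x + 1 ∈ φ A r ↔ x ∈ A r := by
    intro A r x
    simp [φ]
  have hzero : ∀ A r, 0 ∉ φ A r := by
    intro A r
    simp [φ]
  have hφ : ∀ A, IsFilling a (fun x => d.getD x 0) A ↔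
      IsFilling a (fun x => (0 :: d).getD x 0) (φ A) := by
    intro A
    unfold IsFilling
    refine and_congr (by simp [φ]) (and_congr ?_ ?_)
    · refine forall_congr' fun r => forall_congr' fun r' => imp_congr_right fun _ => ?_
      simp [φ]
    · constructor
      · rintro h (_ | x)
        · simp [hzero]
        · simpa [hmem] using h x
      · intro h x
        simpa [hmem] using h (x + 1)
  refine Nat.card_congr (Equiv.ofBijective (fun A => ⟨φ A.1, (hφ A.1).1 A.2⟩) ⟨?_, ?_⟩)
  · intro A B h
    have h := congrArg Subtype.val h
    refine Subtype.ext (funext fun r => Finset.ext fun x => ?_)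
    rw [← hmem A.1, ← hmem B.1]
    exact iff_of_eq (congrArg (fun F => x + 1 ∈ F r) h)
  · rintro ⟨B, hB⟩
    have h0 : ∀ r, 0 ∉ B r := by
      intro r hr
      have := hB.2.2 0
      simp only [List.getD_cons_zero] at this
      rw [Finset.card_eq_zero, Finset.filter_eq_empty_iff] at this
      exact this (Finset.mem_univ r) hr
    let A : Fin k → Finset ℕ := fun r => (B r).preimage Nat.succ Nat.succ_injective.injOn
    have hA : φ A = B := by
      funext r
      ext x
      rcases x with _ | x
      · simp [hzero, h0]
      · rw [hmem]; simp [A]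
    refine ⟨⟨A, (hφ A).2 (hA.symm ▸ hB)⟩, Subtype.ext hA⟩

/-- The set of letters `0` and `i + 1`, for `p i` true. -/
def rowSet {l : ℕ} (p : Fin l → Bool) : Finset ℕ :=
  insert 0 ((Finset.univ.filter fun i => p i = true).image fun i => i.val + 1)

theorem zero_mem_rowSet {l : ℕ} (p : Fin l → Bool) : 0 ∈ rowSet p := by simp [rowSet]

theorem succ_mem_rowSet {l : ℕ} (p : Fin l → Bool) (x : ℕ) :
    x + 1 ∈ rowSet p ↔ ∃ h : x < l, p ⟨x, h⟩ = true := by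
  simp only [rowSet, Finset.mem_insert, Nat.add_eq_zero_iff, one_ne_zero, and_false, false_or,
    Finset.mem_image, Finset.mem_filter, Finset.mem_univ, true_and, Nat.add_right_cancel_iff]
  constructor
  · rintro ⟨i, hi, rfl⟩
    exact ⟨i.2, hi⟩
  · rintro ⟨h, hp⟩
    exact ⟨⟨x, h⟩, hp, rfl⟩

theorem card_rowSet {l : ℕ} (p : Fin l → Bool) : (rowSet p).card = (∑ i, (p i).toNat) + 1 := by
  rw [rowSet, Finset.card_insert_of_notMem (by simp), Finset.card_image_of_injective _
    (fun i j h => Fin.ext (by simpa using h)), Finset.card_filter]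
  congr 1
  refine Finset.sum_congr rfl fun i _ => ?_
  cases p i <;> rfl

theorem getD_ofFn {l : ℕ} (d : Fin l → ℕ) (x : ℕ) :
    (List.ofFn d).getD x 0 = if h : x < l then d ⟨x, h⟩ else 0 := by
  split_ifs with h
  · rw [List.getD_eq_getElem _ _ (by simpa using h), List.getElem_ofFn]
  · rw [List.getD_eq_default _ _ (by simpa using h)]

/-- The letter 0 occurs, so by the first-column condition it lies in the bottom row; p records which
other letters do. A bottom row containing 0 puts no condition on the rows above. -/
theorem card_filling_succ_cons {k l : ℕ} (a : Fin (k + 1) → ℕ) (m : ℕ) (d : Fin l → ℕ) :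
    Nat.card {A // IsFilling a (fun x => ((m + 1) :: List.ofFn d).getD x 0) A} =
      ∑ p : Fin l → Bool, if (∀ i, p i = true → 0 < d i) ∧ (∑ i, (p i).toNat) + 1 = a 0 then
        Nat.card {A // IsFilling (fun r => a r.succ)
          (fun x => (m :: List.ofFn fun i => d i - (p i).toNat).getD x 0) A} else 0 := by
  have hfin : Finite {A // IsFilling a (fun x => ((m + 1) :: List.ofFn d).getD x 0) A} :=
    finite_filling _ _ (getD_eq_zero_of_le _)
  let π : {A // IsFilling a (fun x => ((m + 1) :: List.ofFn d).getD x 0) A} → Fin l → Bool :=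
    fun A i => decide (i.val + 1 ∈ A.1 0)
  have hfirst : ∀ A, A.1 0 = rowSet (π A) := by
    intro A
    ext x
    rcases x with _ | x
    · refine iff_of_true ?_ (zero_mem_rowSet _)
      have h0 := A.2.2.2 0
      simp only [List.getD_cons_zero] at h0
      obtain ⟨r, hr⟩ := Finset.card_pos.1 (by rw [h0]; exact Nat.succ_pos m)
      have hr := (Finset.mem_filter.1 hr).2
      rcases Fin.eq_zero_or_eq_succ r with rfl | ⟨r', rfl⟩
      · exact hr
      · obtain ⟨y, hy, hy0⟩ := A.2.2.1 0 r'.succ (Fin.succ_pos _) 0 hr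
        rwa [Nat.le_zero.1 hy0] at hy
    · rw [succ_mem_rowSet]
      constructor
      · intro h
        have := A.2.lt (getD_eq_zero_of_le _) h
        refine ⟨by simpa using this, by simpa [π] using h⟩
      · rintro ⟨h, hp⟩
        simpa [π] using hp
  have hcons : ∀ A, A.1 = Fin.cons (rowSet (π A)) fun r => A.1 r.succ := by
    intro A
    rw [← hfirst]
    exact (Fin.cons_self_tail A.1).symm
  rw [Nat.card_congr (Equiv.sigmaFiberEquiv π).symm, Nat.card_sigma]
  refine Finset.sum_congr rfl fun p _ => ?_
  by_cases hp : ∀ i, p i = true → 0 < d i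
  · have hc : ∀ x, ((m + 1) :: List.ofFn d).getD x 0 = (if x ∈ rowSet p then 1 else 0) +
        (m :: List.ofFn fun i => d i - (p i).toNat).getD x 0 := by
      rintro (_ | x)
      · simp [zero_mem_rowSet, add_comm]
      · rw [List.getD_cons_succ, List.getD_cons_succ, getD_ofFn, getD_ofFn]
        simp only [succ_mem_rowSet]
        by_cases hx : x < l
        · have := hp ⟨x, hx⟩
          cases h : p ⟨x, hx⟩ <;> simp [hx, h] at this ⊢
          omega
        · simp [hx]
    by_cases ha : (∑ i, (p i).toNat) + 1 = a 0
    · rw [if_pos ⟨hp, ha⟩]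
      refine Nat.card_congr
        { toFun := fun A => ⟨fun r => A.1.1 r.succ, ?_⟩
          invFun := fun B => ⟨⟨(Fin.cons (rowSet p) B.1 : Fin (k + 1) → Finset ℕ), ?_⟩, ?_⟩
          left_inv := ?_
          right_inv := fun _ => rfl }
      · have h := A.1.2
        rw [hcons A.1, A.2] at h
        exact ((isFilling_cons hc).1 h).2.2
      · exact (isFilling_cons hc).2 ⟨(card_rowSet p).trans ha,
          fun r x _ => ⟨0, zero_mem_rowSet p, Nat.zero_le x⟩, B.2⟩
      · funext i
        have : i.val + 1 ∈ rowSet p ↔ p i = true := by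
          rw [succ_mem_rowSet]
          exact ⟨fun ⟨_, h⟩ => h, fun h => ⟨i.2, h⟩⟩
        simp [π, this]
      · intro A
        refine Subtype.ext (Subtype.ext ?_)
        rw [hcons A.1, A.2]
    · rw [if_neg fun h => ha h.2]
      have : IsEmpty {A // π A = p} := ⟨fun A => ha (by
        rw [← card_rowSet, ← A.2, ← hfirst, A.1.2.1])⟩
      exact Nat.card_of_isEmpty
  · rw [if_neg fun h => hp h.1]
    have : IsEmpty {A // π A = p} := ⟨fun A => hp fun i hi => by
      have h1 := A.1.2.2.2 (i.val + 1)
      simp only [List.getD_cons_succ, getD_ofFn, dif_pos i.2, Fin.eta] at h1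
      rw [← h1, Finset.card_pos]
      refine ⟨0, Finset.mem_filter.2 ⟨Finset.mem_univ _, ?_⟩⟩
      have h2 := A.2 ▸ hi
      simpa [π] using h2⟩
    exact Nat.card_of_isEmpty

variable {R : Type*} [CommRing R]

theorem skew_complete (n : ℕ) :
    skew R (complete R n) = C (complete R n) + if 0 < n then X * C (complete R (n - 1)) else 0 := by
  rcases n with _ | n <;> simp

/-- Each factor is either kept or lowered with a factor t. The choices p are those of
`card_filling_succ_cons`. -/
theorem skew_prod_complete {l : ℕ} (d : Fin l → ℕ) :
    skew R (((List.ofFn d).map (complete R)).prod) =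
      ∑ p : Fin l → Bool, if ∀ i, p i = true → 0 < d i then
        X ^ (∑ i, (p i).toNat) *
          C (((List.ofFn fun i => d i - (p i).toNat).map (complete R)).prod) else 0 := by
  induction l with
  | zero => simp
  | succ l ih =>
    rw [List.ofFn_succ, List.map_cons, List.prod_cons, map_mul, ih, skew_complete,
      ← (Fin.consEquiv fun _ : Fin (l + 1) => Bool).sum_comp, Fintype.sum_prod_type,
      Fintype.sum_bool, add_mul, add_comm]
    congr 1
    · rw [Finset.mul_sum]
      refine Finset.sum_congr rfl fun p _ => ?_
      simp only [Fin.consEquiv, Equiv.coe_fn_mk, Fin.forall_fin_succ, Fin.cons_zero,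
        Fin.cons_succ, forall_true_left, Fin.sum_univ_succ, List.ofFn_succ, List.map_cons,
        List.prod_cons, Bool.toNat_true, C_mul]
      by_cases h1 : ∀ i, p i = true → 0 < d i.succ
      · by_cases h0 : 0 < d 0
        · rw [if_pos h0, if_pos h1, if_pos ⟨h0, h1⟩, pow_add, pow_one, mul_assoc X, mul_assoc X,
            ← mul_assoc _ (X ^ _), ← X_pow_mul, mul_assoc (X ^ _)]
        · rw [if_neg h0, if_neg (c := _ ∧ _) fun h => h0 h.1, zero_mul]
      · rw [if_neg h1, if_neg (c := _ ∧ _) fun h => h1 h.2, mul_zero]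
    · rw [Finset.mul_sum]
      refine Finset.sum_congr rfl fun p _ => ?_
      simp only [Fin.consEquiv, Equiv.coe_fn_mk, Fin.forall_fin_succ, Fin.cons_zero,
        Fin.cons_succ, Fin.sum_univ_succ, List.ofFn_succ, List.map_cons,
        List.prod_cons, Bool.toNat_false, C_mul]
      by_cases h1 : ∀ i, p i = true → 0 < d i.succ
      · rw [if_pos h1, if_pos ⟨fun h => absurd h Bool.false_ne_true, h1⟩, zero_add,
          ← mul_assoc, ← X_pow_mul, mul_assoc, Nat.sub_zero]
      · rw [if_neg h1, if_neg (c := _ ∧ _) fun h => h1 h.2, mul_zero]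

theorem natCast_card_filling {k : ℕ} (a : Fin k → ℕ) (ha : ∀ i, 0 < a i) (d : List ℕ) :
    (Nat.card {A // IsFilling a (fun x => d.getD x 0) A} : R) =
      dualFunctional (List.ofFn a) ((d.map (complete R)).prod) := by
  induction k generalizing d with
  | zero =>
    rw [List.ofFn_zero, dualFunctional_nil]
    induction d with
    | nil =>
      have : Nat.card {A // IsFilling a (fun x => ([] : List ℕ).getD x 0) A} = 1 := by
        rw [Nat.card_eq_one_iff_unique]
        exact ⟨⟨fun A B => Subtype.ext (Subsingleton.elim _ _)⟩,
          ⟨⟨fun _ => ∅, fun r => r.elim0, fun r => r.elim0, fun x => by simp⟩⟩⟩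
      rw [this]
      simp
    | cons m d ih =>
      rcases m with _ | m
      · rw [card_filling_zero_cons, ih]
        simp
      · have : IsEmpty {A // IsFilling a (fun x => ((m + 1) :: d).getD x 0) A} :=
          ⟨fun A => by simpa using A.2.2.2 0⟩
        rw [Nat.card_of_isEmpty, List.map_cons, List.prod_cons, map_mul, counit_complete_succ]
        simp
  | succ k ihk =>
    have hcard : ∀ d : List ℕ, (Nat.card {A // IsFilling (fun r => a r.succ)
        (fun x => d.getD x 0) A} : R) = _ := ihk (fun r => a r.succ) fun i => ha _
    induction d with
    | nil =>
      have : IsEmpty {A // IsFilling a (fun x => ([] : List ℕ).getD x 0) A} := ⟨fun A => by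
        obtain ⟨x, hx⟩ := Finset.card_pos.1 (A.2.1 0 ▸ ha 0)
        have := A.2.lt (getD_eq_zero_of_le _) hx
        simp at this⟩
      rw [Nat.card_of_isEmpty, List.ofFn_succ, dualFunctional_cons]
      simp [firstRow_one]
    | cons m d ih =>
      rcases m with _ | m
      · rw [card_filling_zero_cons, ih]
        simp
      · obtain ⟨l, d, rfl⟩ : ∃ (l : ℕ) (d' : Fin l → ℕ), d = List.ofFn d' :=
          ⟨_, _, (List.ofFn_get d).symm⟩
        rw [card_filling_succ_cons, List.ofFn_succ, dualFunctional_cons, List.map_cons,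
          List.prod_cons, firstRow_complete_mul, skew_prod_complete, Finset.mul_sum,
          finsetSum_coeff, map_sum, Nat.cast_sum]
        refine Finset.sum_congr rfl fun p _ => ?_
        have h0 := ha 0
        by_cases hp : ∀ i, p i = true → 0 < d i
        · have heq : (∑ i, (p i).toNat) + 1 = a 0 ↔ a 0 - 1 = ∑ i, (p i).toNat := by omega
          rw [if_pos hp, X_pow_mul, ← mul_assoc, ← C_mul, coeff_C_mul_X_pow]
          by_cases h : a 0 - 1 = ∑ i, (p i).toNat
          · rw [if_pos h, if_pos ⟨hp, heq.2 h⟩, hcard, List.map_cons, List.prod_cons]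
          · rw [if_neg h, if_neg fun h' => h (heq.1 h'.2), map_zero, Nat.cast_zero]
        · rw [if_neg hp, if_neg fun h' => hp h'.1, mul_zero, coeff_zero, map_zero, Nat.cast_zero]

end Fillings

/-! ### Standardization, and the pairing as a tableau count. -/

section Tableaux

variable {n : ℕ} {α : Composition n}

/-- Row-strict immaculate tableaux: rows increase strictly, the first column increases weakly. -/
def IsRowStrictImmaculate (f : Box α → ℕ) : Prop :=
  (∀ b b' : Box α, b.2.val = 0 → b'.2.val = 0 → b.1 < b'.1 → f b ≤ f b') ∧
  (∀ (r : Fin α.length) (c c' : Fin (α.blocksFun r)), c < c' → f ⟨r, c⟩ < f ⟨r, c'⟩)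

/-- The condition on the index sequences of the fundamental function of the complement of the
descent set of `T`. -/
def IsCompatible (T : Box α ≃ Fin n) (i : Fin n → ℕ) : Prop :=
  Monotone i ∧ ∀ j : Fin (n - 1), i ⟨j, by omega⟩ = i ⟨j + 1, by omega⟩ →
    j ∉ setOf (compOf (descents T)ᶜ)

theorem not_mem_setOf_compOf_compl_descents (T : Box α ≃ Fin n) (j : Fin (n - 1)) :
    j ∉ setOf (compOf (descents T)ᶜ) ↔
      (T.symm ⟨j, by omega⟩).1 < (T.symm ⟨j + 1, by omega⟩).1 := by
  rw [setOf, compOf, Equiv.apply_symm_apply, Finset.mem_compl, not_not, descents,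
    Finset.mem_filter]
  simp

/-- On a stretch where i is constant every position is a descent of T, so the rows climb strictly.
-/
theorem IsCompatible.row_lt {T : Box α ≃ Fin n} {i : Fin n → ℕ} (h : IsCompatible T i)
    {p q : Fin n} (hpq : p < q) (hi : i p = i q) : (T.symm p).1 < (T.symm q).1 := by
  obtain ⟨m, hm⟩ : ∃ m, q.val = p.val + m + 1 := ⟨q.val - p.val - 1, by omega⟩
  induction m generalizing q with
  | zero =>
    have h1 := (not_mem_setOf_compOf_compl_descents T ⟨p.val, by omega⟩).1
      (h.2 ⟨p.val, by omega⟩ (by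
        convert hi using 2
        exact Fin.ext hm.symm))
    convert h1 using 3
    exact Fin.ext hm
  | succ m ih =>
    have hq := q.2
    let q' : Fin n := ⟨p.val + m + 1, by omega⟩
    have hpq' : p < q' := Fin.lt_def.2 (by simp only [q']; omega)
    have hqq : q' ≤ q := Fin.le_def.2 (by simp only [q']; omega)
    have h1 : i p = i q' := le_antisymm (h.1 hpq'.le) (hi ▸ h.1 hqq)
    refine (ih hpq' h1 rfl).trans ?_
    have hqe : q = (⟨q'.val + 1, hm ▸ q.2⟩ : Fin n) := Fin.ext hm
    have h2 := (not_mem_setOf_compOf_compl_descents T ⟨q'.val, by simp only [q']; omega⟩).1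
      (h.2 ⟨q'.val, by simp only [q']; omega⟩ ((h1.symm.trans hi).trans (congrArg i hqe)))
    rw [hqe]
    exact h2

/-- The order on boxes determined by a filling. -/
def boxKey (f : Box α → ℕ) (b : Box α) : ℕ ×ₗ Fin α.length := toLex (f b, b.1)

theorem boxKey_lt {f : Box α → ℕ} {b b' : Box α} :
    boxKey f b < boxKey f b' ↔ f b < f b' ∨ f b = f b' ∧ b.1 < b'.1 := by
  simp [boxKey, Prod.Lex.toLex_lt_toLex]

/-- Equal letters are numbered from bottom to top, so `i ∘ T` determines the order of the entries of
T. -/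
theorem IsCompatible.lt_iff {T : Box α ≃ Fin n} {i : Fin n → ℕ} (h : IsCompatible T i)
    (b b' : Box α) : T b < T b' ↔ boxKey (i ∘ T) b < boxKey (i ∘ T) b' := by
  have key : ∀ b b', T b < T b' → boxKey (i ∘ T) b < boxKey (i ∘ T) b' := by
    intro b b' hlt
    rw [boxKey_lt]
    rcases (h.1 hlt.le).lt_or_eq with h1 | h1
    · exact Or.inl h1
    · refine Or.inr ⟨h1, ?_⟩
      simpa using h.row_lt hlt h1
  refine ⟨key b b', fun hlt => ?_⟩
  by_contra hc
  rcases (not_lt.1 hc).lt_or_eq with h1 | h1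
  · exact lt_asymm hlt (key _ _ h1)
  · rw [T.injective h1] at hlt
    exact lt_irrefl _ hlt

theorem IsCompatible.isRowStrictImmaculate {T : Box α ≃ Fin n} {i : Fin n → ℕ}
    (h : IsCompatible T i) (hT : IsStandardImmaculate α T) :
    IsRowStrictImmaculate (i ∘ T) := by
  refine ⟨fun b b' h1 h2 h3 => h.1 (hT.1 b b' h1 h2 h3).le, fun r c c' hcc => ?_⟩
  have h1 := boxKey_lt.1 ((h.lt_iff _ _).1 (hT.2 r c c' hcc))
  rcases h1 with h1 | h1
  · exact h1
  · exact absurd h1.2 (lt_irrefl r)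

/-- T' ∘ T⁻¹ is an order automorphism of `Fin n`, hence the identity. -/
theorem eq_of_lt_iff {T T' : Box α ≃ Fin n} (h : ∀ b b', T b < T b' ↔ T' b < T' b') : T = T' := by
  let e : Fin n ≃o Fin n :=
    { toEquiv := T.symm.trans T'
      map_rel_iff' := fun {p q} => by
        have := h (T.symm q) (T.symm p)
        simp only [Equiv.apply_symm_apply] at this
        simp only [Equiv.trans_apply]
        rw [← not_lt, ← this, not_lt] }
  have he : e = OrderIso.refl _ := Subsingleton.elim _ _
  ext b
  have := congrArg (fun e : Fin n ≃o Fin n => e (T b)) he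
  simp [e] at this
  rw [this]

theorem IsRowStrictImmaculate.boxKey_injective {f : Box α → ℕ} (hf : IsRowStrictImmaculate f) :
    Function.Injective (boxKey f) := by
  rintro ⟨r, c⟩ ⟨r', c'⟩ h
  have h1 : f ⟨r, c⟩ = f ⟨r', c'⟩ := congrArg (fun x => (ofLex x).1) h
  have h2 : r = r' := congrArg (fun x => (ofLex x).2) h
  subst h2
  rcases lt_trichotomy c c' with h | h | h
  · exact absurd h1 (hf.2 r c c' h).ne
  · rw [h]
  · exact absurd h1 (hf.2 r c' c h).ne'

/-- A box receives the rank of its key; keys are distinct because rows increase strictly. -/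
theorem exists_standardization {f : Box α → ℕ} (hf : IsRowStrictImmaculate f) :
    ∃ T : Box α ≃ Fin n, ∀ b b', T b < T b' ↔ boxKey f b < boxKey f b' := by
  classical
  let S : Finset (ℕ ×ₗ Fin α.length) := Finset.univ.image (boxKey f)
  have hS : S.card = n := by
    rw [Finset.card_image_of_injective _ hf.boxKey_injective, Finset.card_univ,
      Fintype.card_sigma]
    simp [α.sum_blocksFun]
  let e : Box α ≃ S := Equiv.ofBijective
    (fun b => ⟨boxKey f b, Finset.mem_image_of_mem _ (Finset.mem_univ b)⟩)
    ⟨fun b b' h => hf.boxKey_injective (congrArg Subtype.val h), by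
      rintro ⟨x, hx⟩
      obtain ⟨b, -, rfl⟩ := Finset.mem_image.1 hx
      exact ⟨b, rfl⟩⟩
  refine ⟨e.trans (S.orderIsoOfFin hS).symm.toEquiv, fun b b' => ?_⟩
  exact (S.orderIsoOfFin hS).symm.lt_iff_lt

theorem exists_compatible {f : Box α → ℕ} (hf : IsRowStrictImmaculate f) :
    ∃ T : Box α ≃ Fin n, IsStandardImmaculate α T ∧ IsCompatible T (f ∘ T.symm) := by
  obtain ⟨T, hT⟩ := exists_standardization hf
  refine ⟨T, ⟨fun b b' h1 h2 h3 => ?_, fun r c c' hcc => ?_⟩, ?_, ?_⟩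
  · rw [hT, boxKey_lt]
    have := hf.1 b b' h1 h2 h3
    rcases this.lt_or_eq with h | h
    · exact Or.inl h
    · exact Or.inr ⟨h, h3⟩
  · rw [hT, boxKey_lt]
    exact Or.inl (hf.2 r c c' hcc)
  · intro p q hpq
    rcases hpq.lt_or_eq with h | rfl
    · have := (hT (T.symm p) (T.symm q)).1 (by simpa using h)
      rcases boxKey_lt.1 this with h | h
      · exact h.le
      · exact h.1.le
    · exact le_rfl
  · intro j hj
    rw [not_mem_setOf_compOf_compl_descents]
    have := (hT (T.symm ⟨j, by omega⟩) (T.symm ⟨j + 1, by omega⟩)).1 (by simp [Fin.lt_def])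
    rcases boxKey_lt.1 this with h | h
    · exact absurd hj h.ne
    · exact h.2

theorem sum_single_comp (T : Box α ≃ Fin n) (i : Fin n → ℕ) :
    ∑ b, Finsupp.single ((i ∘ T) b) 1 = ∑ j, Finsupp.single (i j) 1 :=
  Equiv.sum_comp T fun j => Finsupp.single (i j) 1

/-- Every value of i lies in the finite support of d. Finiteness is needed for `Nat.card` to be
additive over T. -/
theorem finite_sum_single {ι : Type*} [Fintype ι] (d : ℕ →₀ ℕ) (P : (ι → ℕ) → Prop) :
    Finite {i : ι → ℕ // P i ∧ ∑ j, Finsupp.single (i j) 1 = d} := by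
  refine Finite.of_injective (β := ι → d.support) (fun i j => ⟨i.1 j, ?_⟩) ?_
  · rw [Finsupp.mem_support_iff, ← DFunLike.congr_fun i.2.2, Finsupp.finsetSum_apply]
    refine (Finset.sum_pos' (fun _ _ => Nat.zero_le _) ⟨j, Finset.mem_univ _, ?_⟩).ne'
    simp
  · intro i i' h
    refine Subtype.ext (funext fun j => ?_)
    exact congrArg Subtype.val (congrFun h j)

-- The bijection is (T, i) ↦ i ∘ T, with standardization as its inverse.
open Classical in
theorem sum_card_compatible (α : Composition n) (d : ℕ →₀ ℕ) :
    ∑ T : Box α ≃ Fin n with IsStandardImmaculate α T,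
      Nat.card {i : Fin n → ℕ // IsCompatible T i ∧ ∑ j, Finsupp.single (i j) 1 = d} =
    Nat.card {f : Box α → ℕ // IsRowStrictImmaculate f ∧ ∑ b, Finsupp.single (f b) 1 = d} := by
  have hfin := fun T : Box α ≃ Fin n => finite_sum_single d (IsCompatible T)
  rw [← Finset.sum_subtype_eq_sum_filter, Finset.subtype_univ, ← Nat.card_sigma]
  refine Nat.card_congr (Equiv.ofBijective
    (fun x => ⟨x.2.1 ∘ x.1.1, x.2.2.1.isRowStrictImmaculate x.1.2,
      (sum_single_comp x.1.1 x.2.1).trans x.2.2.2⟩) ⟨?_, ?_⟩)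
  · rintro ⟨⟨T, hT⟩, ⟨i, hi, hd⟩⟩ ⟨⟨T', hT'⟩, ⟨i', hi', hd'⟩⟩ h
    have h : i ∘ T = i' ∘ T' := congrArg Subtype.val h
    obtain rfl : T = T' := eq_of_lt_iff fun b b' => by rw [hi.lt_iff, hi'.lt_iff, h]
    obtain rfl : i = i' := T.surjective.injective_comp_right h
    rfl
  · rintro ⟨f, hf, hd⟩
    obtain ⟨T, hT, hc⟩ := exists_compatible hf
    have hfT : (f ∘ T.symm) ∘ T = f := by funext b; simp
    refine ⟨⟨⟨T, hT⟩, ⟨f ∘ T.symm, hc, ?_⟩⟩, Subtype.ext hfT⟩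
    rw [← sum_single_comp T, hfT, hd]

/-- A strictly increasing row is the same as its set of entries, and the first-column condition
compares the minima of these sets. -/
theorem card_rowStrictImmaculate (α : Composition n) (d : ℕ →₀ ℕ) :
    Nat.card {f : Box α → ℕ // IsRowStrictImmaculate f ∧ ∑ b, Finsupp.single (f b) 1 = d} =
      Nat.card {A // IsFilling α.blocksFun d A} := by
  have hmono : ∀ {f : Box α → ℕ}, IsRowStrictImmaculate f → ∀ r,
      StrictMono fun c => f ⟨r, c⟩ := fun hf r c c' h => hf.2 r c c' h
  let φ : (Box α → ℕ) → Fin α.length → Finset ℕ := fun f r =>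
    Finset.univ.image fun c => f ⟨r, c⟩
  have hcol : ∀ f : Box α → ℕ, (∀ r, StrictMono fun c => f ⟨r, c⟩) →
      ((∀ b b' : Box α, b.2.val = 0 → b'.2.val = 0 → b.1 < b'.1 → f b ≤ f b') ↔
        ∀ r r', r < r' → ∀ x ∈ φ f r', ∃ y ∈ φ f r, y ≤ x) := by
    intro f hf
    constructor
    · intro h r r' hr x hx
      obtain ⟨c, -, rfl⟩ := Finset.mem_image.1 hx
      refine ⟨f ⟨r, ⟨0, α.one_le_blocksFun r⟩⟩, Finset.mem_image_of_mem _ (Finset.mem_univ _), ?_⟩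
      refine (h _ ⟨r', ⟨0, α.one_le_blocksFun r'⟩⟩ rfl rfl hr).trans ?_
      exact (hf r').monotone (Fin.le_def.2 (Nat.zero_le _))
    · rintro h ⟨r, c⟩ ⟨r', c'⟩ h1 h2 hr
      obtain ⟨y, hy, hle⟩ := h r r' hr (f ⟨r', c'⟩) (Finset.mem_image_of_mem _ (Finset.mem_univ _))
      obtain ⟨c2, -, rfl⟩ := Finset.mem_image.1 hy
      refine le_trans ?_ hle
      refine (hf r).monotone (Fin.le_def.2 ?_)
      change c.val = 0 at h1
      omega
  have hcontent : ∀ f : Box α → ℕ, (∀ r, StrictMono fun c => f ⟨r, c⟩) →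
      (∑ b, Finsupp.single (f b) 1 = d ↔
        ∀ x, (Finset.univ.filter fun r => x ∈ φ f r).card = d x) := by
    intro f hf
    rw [Finsupp.ext_iff]
    refine forall_congr' fun x => ?_
    have h : (∑ b, Finsupp.single (f b) 1 : ℕ →₀ ℕ) x =
        (Finset.univ.filter fun r => x ∈ φ f r).card := by
      rw [Finsupp.finsetSum_apply, Fintype.sum_sigma, Finset.card_filter]
      refine Finset.sum_congr rfl fun r _ => ?_
      split_ifs with hx
      · obtain ⟨c, -, hc⟩ := Finset.mem_image.1 hx
        rw [Finset.sum_eq_single c]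
        · simp [hc]
        · intro c' _ hne
          rw [Finsupp.single_eq_of_ne]
          intro h
          exact hne ((hf r).injective (h.symm.trans hc.symm))
        · simp
      · refine Finset.sum_eq_zero fun c _ => ?_
        rw [Finsupp.single_eq_of_ne]
        rintro rfl
        exact hx (Finset.mem_image_of_mem _ (Finset.mem_univ _))
    rw [h]
  refine Nat.card_congr (Equiv.ofBijective (fun f => ⟨φ f.1, ?_, ?_, ?_⟩) ⟨?_, ?_⟩)
  · intro r
    rw [Finset.card_image_of_injective _ (hmono f.2.1 r).injective, Finset.card_univ,
      Fintype.card_fin]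
  · exact (hcol f.1 (hmono f.2.1)).1 f.2.1.1
  · exact (hcontent f.1 (hmono f.2.1)).1 f.2.2
  · intro f g h
    have h : φ f.1 = φ g.1 := congrArg Subtype.val h
    refine Subtype.ext (funext fun b => ?_)
    have h1 := congrArg (fun s : Finset ℕ => (s : Set ℕ)) (congrFun h b.1)
    simp only [φ, Finset.coe_image, Finset.coe_univ, Set.image_univ] at h1
    exact congrFun (((hmono f.2.1 b.1).range_inj (hmono g.2.1 b.1)).1 h1) b.2
  · rintro ⟨A, hA⟩
    let f : Box α → ℕ := fun b => (A b.1).orderEmbOfFin (hA.1 b.1) b.2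
    have hf : ∀ r, StrictMono fun c => f ⟨r, c⟩ := fun r =>
      ((A r).orderEmbOfFin (hA.1 r)).strictMono
    have hφ : φ f = A := by
      funext r
      exact (A r).image_orderEmbOfFin_univ (hA.1 r)
    refine ⟨⟨f, ⟨(hcol f hf).2 ?_, fun r c c' h => hf r h⟩, (hcontent f hf).2 ?_⟩,
      Subtype.ext hφ⟩
    · rw [hφ]; exact hA.2.1
    · rw [hφ]; exact hA.2.2

theorem pairing_rowStrictDualImmaculate (R : Type*) [CommRing R] (α : Composition n) :
    pairing R (rowStrictDualImmaculate R α) = dualFunctional α.blocks := by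
  classical
  refine (FreeAlgebra.basisFreeMonoid R ℕ+).ext fun w => ?_
  have h1 : pairing R (rowStrictDualImmaculate R α) (FreeAlgebra.basisFreeMonoid R ℕ+ w) =
      MvPowerSeries.coeff (expo w) (rowStrictDualImmaculate R α) := by
    simp [pairing, Module.Basis.constr_basis]
  rw [h1, rowStrictDualImmaculate, map_sum]
  have h2 : ∀ T : Box α ≃ Fin n, MvPowerSeries.coeff (expo w)
      (fundamentalQSym R (compOf (descents T)ᶜ)) =
      ((Nat.card {i : Fin n → ℕ //
        IsCompatible T i ∧ ∑ j, Finsupp.single (i j) 1 = expo w} : ℕ) : R) := by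
    intro T
    change ((Nat.card _ : ℕ) : R) = _
    congr 1
    refine Nat.card_congr (Equiv.subtypeEquivRight fun i => ?_)
    exact and_assoc.symm
  simp only [h2]
  rw [← Nat.cast_sum, sum_card_compatible, card_rowStrictImmaculate, basis_eq]
  have h3 : (expo w : ℕ → ℕ) =
      fun x => (w.toList.map (fun a : ℕ+ => (a : ℕ))).getD x 0 := funext (expo_apply w)
  rw [h3, natCast_card_filling _ α.one_le_blocksFun, α.ofFn_blocksFun, List.map_map]
  congr 3
  funext a
  exact (iota_eq_complete R a).symm

end Tableaux

/-! ### Existence, uniqueness and the Pieri rule. -/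

section Pieri

variable {R : Type*} [CommRing R]

theorem isDualToRowStrict_immaculate :
    IsDualToRowStrict R fun _ β => immaculate R β.blocks := by
  intro n k α β
  rw [pairing_rowStrictDualImmaculate]
  exact dualFunctional_immaculate _ _ (fun _ h => α.blocks_pos h) (fun _ h => β.blocks_pos h)

theorem IsDualToRowStrict.eq_immaculate {L : (n : ℕ) → Composition n → NSym R}
    (hL : IsDualToRowStrict R L) : L = fun _ β => immaculate R β.blocks := by
  funext k β
  refine eq_of_dualFunctional_eq fun α hα => ?_
  have h1 := hL α.sum k ⟨α, fun h => hα _ h, rfl⟩ β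
  have h2 := isDualToRowStrict_immaculate (R := R) α.sum k ⟨α, fun h => hα _ h, rfl⟩ β
  rw [pairing_rowStrictDualImmaculate] at h1 h2
  exact h1.trans h2.symm

/-- Both sides are tested against every functional δ; on the right this selects at most the term
with parts δ. -/
theorem elementary_mul_immaculate {n m : ℕ} (α : Composition n) (hm : 0 < m) :
    elementary R m * immaculate R α.blocks =
      ∑ β : Composition (n + m) with
          m ≤ β.blocks.headD 0 ∧ α.length ≤ β.length ∧ β.length ≤ α.length + 1,
        pieriCoeff ((β.blocks.headD 0 : ℤ) - (m : ℤ)) α.blocks β.blocks.tail •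
          immaculate R β.blocks := by
  obtain ⟨m, rfl⟩ : ∃ k, m = k + 1 := ⟨m - 1, by omega⟩
  have hα : ∀ x ∈ α.blocks, 0 < x := fun _ h => α.blocks_pos h
  refine eq_of_dualFunctional_eq fun δ hδ => ?_
  have hterm : ∀ β : Composition (n + (m + 1)), dualFunctional δ
      (pieriCoeff ((β.blocks.headD 0 : ℤ) - ((m + 1 : ℕ) : ℤ)) α.blocks β.blocks.tail •
        immaculate R β.blocks) = if δ = β.blocks then
      (pieriCoeff ((δ.headD 0 : ℤ) - ((m + 1 : ℕ) : ℤ)) α.blocks δ.tail : R) else 0 := by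
    intro β
    rw [map_zsmul, dualFunctional_immaculate _ _ hδ fun _ h => β.blocks_pos h, zsmul_eq_mul]
    split_ifs with h
    · rw [h, mul_one]
    · rw [mul_zero]
  rw [map_sum]
  simp only [hterm]
  rcases δ with _ | ⟨b, γ⟩
  · rw [dualFunctional_nil, map_mul, counit_elementary_succ, zero_mul, Finset.sum_eq_zero]
    intro β _
    refine if_neg fun h => ?_
    have := β.blocks_sum
    rw [← h] at this
    simp at this
  obtain ⟨b, rfl⟩ : ∃ k, b = k + 1 := ⟨b - 1, by have := hδ b (by simp); omega⟩
  have hγ : ∀ x ∈ γ, 0 < x := fun x h => hδ x (by simp [h])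
  rw [dualFunctional_cons_elementary_mul]
  simp only [List.headD_cons, List.tail_cons]
  -- When the coefficient is nonzero, δ is itself an index of the sum, by `pieriCoeff_sum` and
  -- `pieriCoeff_length`; otherwise both sides vanish.
  by_cases hc : m ≤ b ∧ pieriCoeff (((b + 1 : ℕ) : ℤ) - ((m + 1 : ℕ) : ℤ)) α.blocks γ ≠ 0
  · have hs : ((b + 1 : ℕ) : ℤ) - ((m + 1 : ℕ) : ℤ) = (b - m : ℕ) := by omega
    rw [if_pos hc.1, dualFunctional_skewCoeff_immaculate hα hγ, hs]
    have hsum := pieriCoeff_sum hα hγ (by omega) hc.2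
    have hlen := pieriCoeff_length hc.2
    rw [α.blocks_sum] at hsum
    rw [α.blocks_length] at hlen
    let β : Composition (n + (m + 1)) :=
      ⟨(b + 1) :: γ, fun h => hδ _ h, by rw [List.sum_cons]; omega⟩
    rw [Finset.sum_eq_single β]
    · rw [if_pos rfl]
    · intro β' _ hne
      exact if_neg fun h => hne (Composition.ext h.symm)
    · intro h
      refine absurd (Finset.mem_filter.2 ⟨Finset.mem_univ _, ?_⟩) h
      refine ⟨Nat.succ_le_succ hc.1, ?_⟩
      change α.length ≤ γ.length + 1 ∧ γ.length + 1 ≤ α.length + 1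
      omega
  · rw [Finset.sum_eq_zero]
    · split_ifs with h
      · have hs : ((b + 1 : ℕ) : ℤ) - ((m + 1 : ℕ) : ℤ) = (b - m : ℕ) := by omega
        rw [hs] at hc
        rw [dualFunctional_skewCoeff_immaculate hα hγ, not_not.1 fun h' => hc ⟨h, h'⟩,
          Int.cast_zero]
      · rfl
    · intro β hβ
      split_ifs with h
      · have hb := (Finset.mem_filter.1 hβ).2.1
        rw [← h, List.headD_cons] at hb
        rw [not_not.1 fun h' => hc ⟨by omega, h'⟩, Int.cast_zero]
      · rfl

end Pieri

end RowStrict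

theorem corollary4 (R : Type*) [CommRing R] :
    ∃ RI : (n : ℕ) → Composition n → RowStrict.NSym R,
      RowStrict.IsDualToRowStrict R RI ∧
      (∀ L : (n : ℕ) → Composition n → RowStrict.NSym R,
        RowStrict.IsDualToRowStrict R L → L = RI) ∧
      ∀ (n m : ℕ) (α : Composition n), 0 < m →
        RowStrict.elementary R m * RI n α =
          ∑ β : Composition (n + m) with
              m ≤ β.blocks.headD 0 ∧ α.length ≤ β.length ∧ β.length ≤ α.length + 1,
            RowStrict.pieriCoeff ((β.blocks.headD 0 : ℤ) - (m : ℤ)) α.blocks β.blocks.tail •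
              RI (n + m) β :=
  ⟨fun _ β => RowStrict.immaculate R β.blocks, RowStrict.isDualToRowStrict_immaculate,
    fun _ hL => hL.eq_immaculate, fun _ _ α hm => RowStrict.elementary_mul_immaculate α hm⟩
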